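/- **Conventions.** All graphs are locally finite. A random rooted (marked) graph is a random element of the space of isomorphism classes of connected, locally finite rooted (marked) graphs $(G,\rho)$ with the Borel $\sigma$-algebra of the local topology. It is unimodular if it satisfies the mass transport principle $\mathbb E\big[\sum_{o\in V(G)}f(G,\rho,o)\big]=\mathbb E\big[\sum_{o\in V(G)}f(G,o,\rho)\big]$ for every nonnegative Borel function $f$ of doubly rooted (marked) graphs. A percolation of a unimodular random rooted (marked) graph is a random $\{0,1\}$-marking of its vertices and edges, jointly unimodular with it, such that the endpoints of every open edge (mark $1$) are open; vertices and edges with mark $0$ are closed. It is a site percolation if every edge with two open endpoints is open. Its rate is the probability that the root is closed. $G[\xi]$ denotes the graph formed by the vertices and edges that are open for $\xi$. The inner vertex-expansion constant of a graph is the infimum, over its nonempty finite vertex sets $K$, of $|\partial_{\mathrm{in}}K|/|K|$, where $\partial_{\mathrm{in}}K$ is the set of vertices of $K$ adjacent to some vertex outside $K$. **Theorem 5.1.** Let $\alpha>0$ be real, let $D\ge 2$ be an integer and let $\varepsilon\in(0,1/2)$. There is a positive integer $h=h(\varepsilon)$ (depending only on $\alpha$, $D$ and $\varepsilon$) with the following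 property. Let $(G,\rho)$ be a unimodular random rooted graph and let $\xi$ be a percolation of it such that, almost surely, every vertex of $G[\xi]$ has degree at most $D$ in $G[\xi]$ and every infinite connected component of $G[\xi]$ has inner vertex-expansion constant at least $\alpha$. Then for every positive integer $N$ there is a site percolation $\omega$ of $(G,\rho)$ (jointly with $\xi$, that is, of the marked graph $(G,\rho,\xi)$), of rate at most $\varepsilon$, such that almost surely: (I) every vertex of $G[\xi]$ that is open for $\omega$ and belongs to an infinite connected component of $G[\xi]$ is at distance at most $h$ in $G[\xi]$ from some vertex of $G[\xi]$ that is closed for $\omega$; (II) every vertex $v$ of $G[\xi]$ that is closed for $\omega$ belongs to a set $\Psi$ of at least $N$ vertices of $G[\xi]$, all closed for $\omega$, such that the subgraph of $G[\xi]$ induced by $\Psi$ is connected. -/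

import Mathlib

open MeasureTheory
open scoped ENNReal

/-! ### Marked graphs and their isomorphism classes

A connected locally finite graph is countable, so every one of them is isomorphic to a graph whose
vertex set is a subset of `ℕ`, that is, to a subgraph of the complete graph on `ℕ`. -/

/-- A connected, locally finite graph with vertex set contained in `ℕ`, whose vertices and edges
carry marks in `X`. Only the values of `vmark` at vertices of the graph and of `emark` at edges of
the graph are meaningful: isomorphisms ignore the other values. -/
structure MarkedGraph (X : Type*) where
  graph : (⊤ : SimpleGraph ℕ).Subgraph
  connected : graph.Connected
  locallyFinite : ∀ v, (graph.neighborSet v).Finite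
  vmark : ℕ → X
  emark : Sym2 ℕ → X

/-- A marked graph together with `k` distinguished vertices (the roots). -/
structure RootedMarkedGraph (X : Type*) (k : ℕ) extends MarkedGraph X where
  root : Fin k → graph.verts

namespace RootedMarkedGraph

variable {X Y : Type*} {k : ℕ}

/-- Isomorphism of marked graphs with `k` roots: a graph isomorphism which preserves the roots, the
marks of the vertices and the marks of the edges. -/
def Isomorphic (a b : RootedMarkedGraph X k) : Prop :=
  ∃ e : a.graph.coe ≃g b.graph.coe,
    (∀ i, e (a.root i) = b.root i) ∧
    (∀ v : a.graph.verts, b.vmark (e v) = a.vmark v) ∧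
    (∀ u v : a.graph.verts, a.graph.Adj u v → b.emark s(↑(e u), ↑(e v)) = a.emark s(↑u, ↑v))

instance isoSetoid (X : Type*) (k : ℕ) : Setoid (RootedMarkedGraph X k) where
  r := Isomorphic
  iseqv :=
    { refl := fun a => ⟨SimpleGraph.Iso.refl, by simp, by simp, by simp⟩
      symm := by
        rintro a b ⟨e, h1, h2, h3⟩
        refine ⟨e.symm, fun i => ?_, fun v => ?_, fun u v huv => ?_⟩
        · rw [← h1, RelIso.symm_apply_apply]
        · rw [← h2, RelIso.apply_symm_apply]
        · have h4 : a.graph.Adj (e.symm u) (e.symm v) :=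
            (e.symm.map_adj_iff (v := u) (w := v)).2 huv
          rw [← h3 _ _ h4, RelIso.apply_symm_apply, RelIso.apply_symm_apply]
      trans := by
        rintro a b c ⟨e, h1, h2, h3⟩ ⟨e', h1', h2', h3'⟩
        refine ⟨e.trans e', fun i => ?_, fun v => ?_, fun u v huv => ?_⟩
        · rw [RelIso.trans_apply, h1, h1']
        · rw [RelIso.trans_apply, h2', h2]
        · have h4 : b.graph.Adj (e u) (e v) := (e.map_adj_iff (v := u) (w := v)).2 huv
          rw [RelIso.trans_apply, RelIso.trans_apply, h3' _ _ h4, h3 _ _ huv] }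

/-- The σ-algebra on concrete marked graphs generated by all vertices, adjacencies, roots and
marks. -/
instance [MeasurableSpace X] : MeasurableSpace (RootedMarkedGraph X k) :=
  MeasurableSpace.comap
    (fun g : RootedMarkedGraph X k =>
      ((fun v => v ∈ g.graph.verts : ℕ → Prop), (fun u v => g.graph.Adj u v : ℕ → ℕ → Prop),
        (fun i => (g.root i : ℕ) : Fin k → ℕ), g.vmark, g.emark))
    inferInstance

/-- Replace the roots of a marked graph by the two vertices `u` and `v`. -/
def withRoots (g : RootedMarkedGraph X k) (u v : g.graph.verts) : RootedMarkedGraph X 2 where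
  toMarkedGraph := g.toMarkedGraph
  root := ![u, v]

/-- Apply a function to all the marks. -/
def mapMarks (φ : X → Y) (g : RootedMarkedGraph X k) : RootedMarkedGraph Y k where
  graph := g.graph
  connected := g.connected
  locallyFinite := g.locallyFinite
  vmark := fun v => φ (g.vmark v)
  emark := fun e => φ (g.emark e)
  root := g.root

end RootedMarkedGraph

/-- The space of isomorphism classes of connected, locally finite `X`-marked graphs with `k` roots:
`GraphClass X 1` is the space of rooted marked graphs, `GraphClass X 2` the space of doubly rooted
marked graphs. -/
def GraphClass (X : Type*) (k : ℕ) : Type _ :=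
  Quotient (RootedMarkedGraph.isoSetoid X k)

/-- A set of isomorphism classes is measurable when the set of its concrete representatives is.
For a Polish space `X` of marks this is the Borel σ-algebra of the local topology: the concrete
marked graphs form a standard Borel space, which the quotient map sends onto the separable metric
space of isomorphism classes by a Borel map, and by a theorem of Suslin a subset of the target of
such a map is Borel as soon as its preimage is
(`Measurable.measurableSet_preimage_iff_of_surjective`). -/
instance {X : Type*} {k : ℕ} [MeasurableSpace X] : MeasurableSpace (GraphClass X k) :=
  inferInstanceAs (MeasurableSpace (Quotient (RootedMarkedGraph.isoSetoid X k)))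

namespace GraphClass

variable {X Y : Type*} {k : ℕ}

/-- The isomorphism class of a marked graph with `k` roots. -/
def mk (g : RootedMarkedGraph X k) : GraphClass X k :=
  Quotient.mk _ g

/-- The isomorphism class `q` has the property `P` of marked graphs. (All the properties to which
this is applied below are invariant under isomorphism.) -/
def Holds (P : RootedMarkedGraph X k → Prop) (q : GraphClass X k) : Prop :=
  ∀ g : RootedMarkedGraph X k, mk g = q → P g

/-- Apply a function to all the marks. -/
def mapMarks (φ : X → Y) : GraphClass X k → GraphClass Y k :=
  Quotient.map (RootedMarkedGraph.mapMarks φ) (by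
    rintro a b ⟨e, h1, h2, h3⟩
    exact ⟨e, h1, fun v => congrArg φ (h2 v), fun u v huv => congrArg φ (h3 u v huv)⟩)

/-- The total mass `∑_{o ∈ V(G)} f(G, ρ, o)` which leaves the root. -/
noncomputable def massOut (f : GraphClass X 2 → ℝ≥0∞) : GraphClass X 1 → ℝ≥0∞ :=
  Quotient.lift (fun g => ∑' o : g.graph.verts, f (mk (g.withRoots (g.root 0) o))) (by
    rintro a b ⟨e, h1, h2, h3⟩
    refine Eq.trans (tsum_congr fun o => ?_)
      (e.toEquiv.tsum_eq (fun o => f (mk (b.withRoots (b.root 0) o))))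
    refine congrArg f (Quotient.sound ⟨e, fun i => ?_, h2, h3⟩)
    fin_cases i
    · exact h1 0
    · rfl)

/-- The total mass `∑_{o ∈ V(G)} f(G, o, ρ)` which enters the root. -/
noncomputable def massIn (f : GraphClass X 2 → ℝ≥0∞) : GraphClass X 1 → ℝ≥0∞ :=
  Quotient.lift (fun g => ∑' o : g.graph.verts, f (mk (g.withRoots o (g.root 0)))) (by
    rintro a b ⟨e, h1, h2, h3⟩
    refine Eq.trans (tsum_congr fun o => ?_)
      (e.toEquiv.tsum_eq (fun o => f (mk (b.withRoots o (b.root 0)))))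
    refine congrArg f (Quotient.sound ⟨e, fun i => ?_, h2, h3⟩)
    fin_cases i
    · rfl
    · exact h1 0)

end GraphClass

/-! ### Unimodularity, markings and percolations

A random rooted marked graph is given by its law, a probability measure on `GraphClass X 1`. -/

/-- `μ` is the law of a unimodular random rooted `X`-marked graph: it is a probability measure
which satisfies the mass transport principle. -/
structure IsUnimodular {X : Type*} [MeasurableSpace X] (μ : Measure (GraphClass X 1)) : Prop where
  isProbabilityMeasure : IsProbabilityMeasure μ
  massTransport : ∀ f : GraphClass X 2 → ℝ≥0∞, Measurable f →
    ∫⁻ q, GraphClass.massOut f q ∂μ = ∫⁻ q, GraphClass.massIn f q ∂μ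

/-- `ν` is the joint law of the random rooted marked graph with law `μ` and of a `Y`-marking of it:
the pair is unimodular, and forgetting the new marks gives back `μ`. -/
structure IsMarking {X Y : Type*} [MeasurableSpace X] [MeasurableSpace Y]
    (μ : Measure (GraphClass X 1)) (ν : Measure (GraphClass (X × Y) 1)) : Prop where
  isUnimodular : IsUnimodular ν
  map_fst : ν.map (GraphClass.mapMarks Prod.fst) = μ

namespace RootedMarkedGraph

variable {X : Type*} {k : ℕ}

/-- The vertex `v` is open with respect to the last `{0,1}`-marking. -/
def VOpen (g : RootedMarkedGraph (X × Bool) k) (v : ℕ) : Prop := (g.vmark v).2 = true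

/-- The edge `e` is open with respect to the last `{0,1}`-marking. -/
def EOpen (g : RootedMarkedGraph (X × Bool) k) (e : Sym2 ℕ) : Prop := (g.emark e).2 = true

/-- The graph of all the open vertices and all the open edges (with open endpoints). -/
def openSubgraph (g : RootedMarkedGraph (X × Bool) k) : (⊤ : SimpleGraph ℕ).Subgraph where
  verts := {v | v ∈ g.graph.verts ∧ g.VOpen v}
  Adj u v := g.graph.Adj u v ∧ g.EOpen s(u, v) ∧ g.VOpen u ∧ g.VOpen v
  adj_sub h := h.1.adj_sub
  edge_vert h := ⟨h.1.fst_mem, h.2.2.1⟩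
  symm := ⟨fun _ _ h => ⟨h.1.symm, Sym2.eq_swap ▸ h.2.1, h.2.2.2, h.2.2.1⟩⟩

end RootedMarkedGraph

/-- `ν` is the joint law of the random rooted marked graph with law `μ` and of a percolation of it:
a `{0,1}`-marking such that both endpoints of every open edge are open. -/
structure IsPercolation {X : Type*} [MeasurableSpace X]
    (μ : Measure (GraphClass X 1)) (ν : Measure (GraphClass (X × Bool) 1)) : Prop where
  isMarking : IsMarking μ ν
  open_of_edge : ∀ᵐ q ∂ν, q.Holds fun g => ∀ u v, g.graph.Adj u v →
    g.EOpen s(u, v) → g.VOpen u ∧ g.VOpen v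

/-- A site percolation: every edge whose endpoints are both open is open. -/
structure IsSitePercolation {X : Type*} [MeasurableSpace X]
    (μ : Measure (GraphClass X 1)) (ν : Measure (GraphClass (X × Bool) 1)) : Prop where
  isPercolation : IsPercolation μ ν
  edge_of_open : ∀ᵐ q ∂ν, q.Holds fun g => ∀ u v, g.graph.Adj u v →
    g.VOpen u → g.VOpen v → g.EOpen s(u, v)

/-- The rate of a percolation: the probability that the root is closed. -/
noncomputable def percolationRate {X : Type*} [MeasurableSpace X]
    (ν : Measure (GraphClass (X × Bool) 1)) : ℝ≥0∞ :=
  ν {q | q.Holds fun g => ¬ g.VOpen (g.root 0)}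

/-! ### Expansion -/

/-- The inner vertex boundary of a set of vertices. -/
def innerBoundary {V : Type*} (G : SimpleGraph V) (K : Set V) : Set V :=
  {u | u ∈ K ∧ ∃ v, v ∉ K ∧ G.Adj u v}

/-- The inner vertex-expansion constant of a graph (which is meant to have a vertex). -/
noncomputable def vertexExpansionConstant {V : Type*} (G : SimpleGraph V) : ℝ :=
  sInf {r : ℝ | ∃ K : Finset V, K.Nonempty ∧
    r = ((innerBoundary G (K : Set V)).ncard : ℝ) / (K.card : ℝ)}

namespace RootedMarkedGraph

variable {X : Type*} {k : ℕ}

/-- Every vertex of the open subgraph has degree at most `D` in it. -/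
def OpenDegreeLE (D : ℕ) (g : RootedMarkedGraph (X × Bool) k) : Prop :=
  ∀ v ∈ g.openSubgraph.verts, (g.openSubgraph.neighborSet v).encard ≤ D

/-- Every infinite connected component of the open subgraph has inner vertex-expansion constant at
least `α`. -/
def InfiniteClustersExpand (α : ℝ) (g : RootedMarkedGraph (X × Bool) k) : Prop :=
  ∀ C : g.openSubgraph.coe.ConnectedComponent, C.supp.Infinite →
    α ≤ vertexExpansionConstant C.toSimpleGraph

/-- Now let the marks encode two successive percolations `ξ` and `ω`, in this order. This is the
open subgraph `G[ξ]` of the first one. -/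
def firstOpenSubgraph (g : RootedMarkedGraph ((X × Bool) × Bool) k) :
    (⊤ : SimpleGraph ℕ).Subgraph :=
  (g.mapMarks Prod.fst).openSubgraph

/-- Each vertex of `G[ξ]` which is open for `ω` and lies in an infinite connected component of
`G[ξ]` is at distance at most `h` in `G[ξ]` from a vertex of `G[ξ]` which is closed for `ω`. -/
def ClosedWithin (h : ℕ) (g : RootedMarkedGraph ((X × Bool) × Bool) k) : Prop :=
  ∀ v : g.firstOpenSubgraph.verts, g.VOpen v →
    (g.firstOpenSubgraph.coe.connectedComponentMk v).supp.Infinite →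
    ∃ w : g.firstOpenSubgraph.verts, ¬ g.VOpen w ∧ g.firstOpenSubgraph.coe.edist v w ≤ h

/-- Each vertex of `G[ξ]` which is closed for `ω` lies in a set `Ψ` of at least `N` vertices of
`G[ξ]`, all closed for `ω`, such that the subgraph of `G[ξ]` induced by `Ψ` is connected. -/
def ClosedInLargeConnected (N : ℕ) (g : RootedMarkedGraph ((X × Bool) × Bool) k) : Prop :=
  ∀ v : g.firstOpenSubgraph.verts, ¬ g.VOpen v →
    ∃ Ψ : Set g.firstOpenSubgraph.verts, v ∈ Ψ ∧ (N : ℕ∞) ≤ Ψ.encard ∧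
      (∀ w ∈ Ψ, ¬ g.VOpen w) ∧ (g.firstOpenSubgraph.coe.induce Ψ).Connected

end RootedMarkedGraph

/-! ### Distances in graphs -/

namespace SimpleGraph

variable {V V' : Type*} {H : SimpleGraph V} {u v w : V} {n : ℕ}

/-! Put independent uniform labels on the vertices and work in the infinite clusters of `G[ξ]`. A
hub is a vertex whose label is below `p`, or which sees no such label within distance `r`. Hubs are
thus `r`-dense, and hubs chosen near the two ends of an edge are at most `2 * r + 1` apart. Seeds
are the vertices with label below `δ`; almost surely every infinite cluster has one, and walking
towards it shows that each hub reaches a seed by finitely many hops (`exists_edist_le_hop`). A hub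
that is not a seed closes one path, its road, of at most `2 * r + 2` vertices, ending at a vertex
with fewer hops to go. Following roads therefore leads to a seed (`Hop.exists_reachable_within`),
and closing the `N`-ball of each seed makes the closed cluster large.

For the rate, expansion makes balls grow exponentially
(`one_le_mul_ncard_of_le_vertexExpansionConstant`), so a hub has probability at most `p + (1 - p) ^
|B_r|`. With `p = 1 / (r + 1) ^ 2` this is `o(1 / r)`. By mass transport from builders to the
vertices of their roads, the roads have density at most `2 * r + 2` times that probability, hence at
most `ε / 2` for large `r`. The balls around seeds cost at most `(D + 1) ^ N * δ`, again at most `ε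
/ 2` for small `δ`. Only `δ` depends on `N`, so `h = r` does not.

The rule is equivariant, ties between paths being broken by the labels. Averaging a transport over
the labels gives a transport of the original graph, so the resulting law is unimodular
(`SiteFactor.isUnimodular_law`). -/

theorem edist_le_coe_iff_exists_walk :
    H.edist u v ≤ n ↔ ∃ q : H.Walk u v, q.length ≤ n := by
  constructor
  · intro h
    obtain ⟨q, hq⟩ := exists_walk_of_edist_ne_top (ne_top_of_le_ne_top (ENat.natCast_ne_top n) h)
    exact ⟨q, by rw [← hq] at h; exact_mod_cast h⟩
  · rintro ⟨q, hq⟩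
    exact (edist_le q).trans (by exact_mod_cast hq)

theorem edist_le_zero_iff : H.edist u v ≤ ((0 : ℕ) : ℕ∞) ↔ u = v := by
  simp

/-- Distances enter only through the predicates `edist ≤ n`. This recursion on `n` drives the
inductions below, including the proofs of invariance and of measurability. -/
theorem edist_le_succ_iff :
    H.edist u v ≤ ((n + 1 : ℕ) : ℕ∞) ↔ H.edist u v ≤ n ∨ ∃ w, H.Adj u w ∧ H.edist w v ≤ n := by
  constructor
  · intro h
    obtain ⟨q, hq⟩ := edist_le_coe_iff_exists_walk.1 h
    cases q with
    | nil => exact Or.inl (by simp)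
    | cons hadj q' =>
      refine Or.inr ⟨_, hadj, edist_le_coe_iff_exists_walk.2 ⟨q', ?_⟩⟩
      simpa using hq
  · rintro (h | ⟨w, hw, h⟩)
    · exact h.trans (by exact_mod_cast Nat.le_succ n)
    · obtain ⟨q, hq⟩ := edist_le_coe_iff_exists_walk.1 h
      exact edist_le_coe_iff_exists_walk.2 ⟨Walk.cons hw q, by simpa using hq⟩

theorem edist_le_succ_iff' :
    H.edist u v ≤ ((n + 1 : ℕ) : ℕ∞) ↔ H.edist u v ≤ n ∨ ∃ w, H.edist u w ≤ n ∧ H.Adj w v := by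
  rw [edist_comm, edist_le_succ_iff, edist_comm]
  refine or_congr_right (exists_congr fun w => ?_)
  rw [edist_comm, adj_comm, and_comm]

theorem edist_le_add {m n : ℕ} (h : H.edist u v ≤ m) (h' : H.edist v w ≤ n) :
    H.edist u w ≤ ((m + n : ℕ) : ℕ∞) :=
  (H.edist_triangle).trans (by push_cast; exact add_le_add h h')

theorem reachable_iff_exists_edist_le : H.Reachable u v ↔ ∃ m : ℕ, H.edist u v ≤ m := by
  constructor
  · rintro ⟨q⟩
    exact ⟨q.length, edist_le q⟩
  · rintro ⟨m, hm⟩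
    exact reachable_of_edist_ne_top (ne_top_of_le_ne_top (ENat.natCast_ne_top m) hm)

/-- A path that leaves the ball of radius `n` crosses the sphere of radius `n + 1`. -/
theorem exists_edist_between {k : ℕ} (h : H.edist u v ≤ k) (h' : ¬ H.edist u v ≤ n) :
    ∃ w, H.edist u w ≤ ((n + 1 : ℕ) : ℕ∞) ∧ ¬ H.edist u w ≤ n := by
  induction k generalizing v with
  | zero => exact absurd (h.trans (by exact_mod_cast Nat.zero_le n)) h'
  | succ k ih =>
    rcases edist_le_succ_iff'.1 h with h | ⟨w, hw, hadj⟩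
    · exact ih h h'
    · by_cases hn : H.edist u w ≤ n
      · exact ⟨v, edist_le_succ_iff'.2 (Or.inr ⟨w, hn, hadj⟩), h'⟩
      · exact ih hw hn

/-! ### Embeddings onto unions of clusters -/

/-- An injective map of graphs which identifies its source with a union of connected components
of its target. -/
structure IsClusterEmbedding (H : SimpleGraph V) (H' : SimpleGraph V') (f : V → V') : Prop where
  injective : Function.Injective f
  adj_iff : ∀ u w', H'.Adj (f u) w' ↔ ∃ w, f w = w' ∧ H.Adj u w

namespace IsClusterEmbedding

variable {H' : SimpleGraph V'} {f : V → V'} (hf : IsClusterEmbedding H H' f)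
include hf

theorem adj_map_iff : H'.Adj (f u) (f v) ↔ H.Adj u v := by
  rw [hf.adj_iff]
  exact ⟨fun ⟨w, hw, h⟩ => hf.injective hw ▸ h, fun h => ⟨v, rfl, h⟩⟩

/-- No edge leaves the image of `f`, so balls around image points stay inside the image. Quantifiers
over balls therefore transfer along `f`, and so does every notion built from them. -/
theorem edist_le_iff {w' : V'} : H'.edist (f u) w' ≤ n ↔ ∃ w, f w = w' ∧ H.edist u w ≤ n := by
  induction n generalizing u with
  | zero =>
    simp only [edist_le_zero_iff]
    exact ⟨fun h => ⟨u, h, rfl⟩, fun ⟨w, hw, h⟩ => h ▸ hw⟩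
  | succ n ih =>
    simp only [edist_le_succ_iff, ih, hf.adj_iff]
    constructor
    · rintro (⟨w, hw, h⟩ | ⟨_, ⟨x, rfl, hx⟩, h⟩)
      · exact ⟨w, hw, Or.inl h⟩
      · obtain ⟨w, hw, h⟩ := ih.1 h
        exact ⟨w, hw, Or.inr ⟨x, hx, h⟩⟩
    · rintro ⟨w, hw, h | ⟨x, hx, h⟩⟩
      · exact Or.inl ⟨w, hw, h⟩
      · exact Or.inr ⟨f x, ⟨x, rfl, hx⟩, ih.2 ⟨w, hw, h⟩⟩

theorem edist_map_le_iff : H'.edist (f u) (f v) ≤ n ↔ H.edist u v ≤ n := by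
  rw [hf.edist_le_iff]
  exact ⟨fun ⟨w, hw, h⟩ => hf.injective hw ▸ h, fun h => ⟨v, rfl, h⟩⟩

theorem exists_adj {P : V' → Prop} :
    (∃ w', H'.Adj (f u) w' ∧ P w') ↔ ∃ w, H.Adj u w ∧ P (f w) := by
  simp only [hf.adj_iff]
  exact ⟨fun ⟨_, ⟨w, rfl, h⟩, h'⟩ => ⟨w, h, h'⟩, fun ⟨w, h, h'⟩ => ⟨_, ⟨w, rfl, h⟩, h'⟩⟩

theorem forall_adj {P : V' → Prop} :
    (∀ w', H'.Adj (f u) w' → P w') ↔ ∀ w, H.Adj u w → P (f w) := by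
  simp only [hf.adj_iff]
  exact ⟨fun h w hw => h _ ⟨w, rfl, hw⟩, fun h _ ⟨w, hw, h'⟩ => hw ▸ h w h'⟩

theorem exists_edist_le {P : V' → Prop} :
    (∃ w', H'.edist (f u) w' ≤ n ∧ P w') ↔ ∃ w, H.edist u w ≤ n ∧ P (f w) := by
  simp only [hf.edist_le_iff]
  exact ⟨fun ⟨_, ⟨w, rfl, h⟩, h'⟩ => ⟨w, h, h'⟩, fun ⟨w, h, h'⟩ => ⟨_, ⟨w, rfl, h⟩, h'⟩⟩

theorem forall_edist_le {P : V' → Prop} :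
    (∀ w', H'.edist (f u) w' ≤ n → P w') ↔ ∀ w, H.edist u w ≤ n → P (f w) := by
  simp only [hf.edist_le_iff]
  exact ⟨fun h w hw => h _ ⟨w, rfl, hw⟩, fun h _ ⟨w, hw, h'⟩ => hw ▸ h w h'⟩

theorem image_setOf_edist_le : f '' {w | H.edist u w ≤ n} = {w' | H'.edist (f u) w' ≤ n} := by
  ext w'
  simp only [Set.mem_image, Set.mem_ofPred_eq, hf.edist_le_iff]
  exact exists_congr fun w => and_comm

end IsClusterEmbedding

/-! ### Vertices in unbounded clusters -/

/-- There are vertices at every distance from `v`. -/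
def Unbounded (H : SimpleGraph V) (v : V) : Prop :=
  ∀ n : ℕ, ∃ w, H.edist v w ≤ ((n + 1 : ℕ) : ℕ∞) ∧ ¬ H.edist v w ≤ n

theorem IsClusterEmbedding.unbounded_iff {H' : SimpleGraph V'} {f : V → V'}
    (hf : IsClusterEmbedding H H' f) : H'.Unbounded (f v) ↔ H.Unbounded v := by
  unfold Unbounded
  simp only [hf.exists_edist_le, hf.edist_map_le_iff]

theorem Unbounded.of_edist_le {m : ℕ} (hv : H.Unbounded v) (h : H.edist v w ≤ m) :
    H.Unbounded w := by
  intro n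
  obtain ⟨x, hx, hx'⟩ := hv (m + n)
  rw [edist_comm] at h
  refine exists_edist_between (edist_le_add h hx) fun hn => hx' ?_
  rw [edist_comm] at h
  exact edist_le_add h hn

theorem finite_setOf_edist_le (hfin : ∀ v, (H.neighborSet v).Finite) (v : V) (n : ℕ) :
    {w | H.edist v w ≤ n}.Finite := by
  induction n generalizing v with
  | zero =>
    simp only [edist_le_zero_iff]
    exact (Set.finite_singleton v).subset fun w hw => hw.symm
  | succ n ih =>
    refine ((ih v).union ((hfin v).biUnion fun w _ => ih w)).subset fun x hx => ?_
    rcases edist_le_succ_iff.1 hx with h | ⟨w, hw, h⟩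
    · exact Or.inl h
    · exact Or.inr (Set.mem_biUnion (show w ∈ H.neighborSet v from hw) h)

/-- Balls are finite, so an infinite cluster leaves each of them. `Unbounded` stands in for
infiniteness because it is a countable combination of conditions `edist ≤ n`, hence visibly
measurable and invariant. -/
theorem unbounded_of_infinite (hfin : ∀ v, (H.neighborSet v).Finite)
    (hv : {w | H.Reachable v w}.Infinite) : H.Unbounded v := by
  intro n
  obtain ⟨x, hx, hx'⟩ := hv.exists_notMem_finite (finite_setOf_edist_le hfin v n)
  obtain ⟨m, hm⟩ := reachable_iff_exists_edist_le.1 hx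
  exact exists_edist_between hm hx'

theorem Unbounded.infinite (hv : H.Unbounded v) : {w | H.Reachable v w}.Infinite := by
  choose x hx hx' using hv
  refine Set.infinite_of_injective_forall_mem (f := x) ?_
    fun n => reachable_iff_exists_edist_le.2 ⟨_, hx n⟩
  have key : ∀ m n, m < n → x m ≠ x n := fun m n hmn h =>
    hx' n (h ▸ (hx m).trans (by exact_mod_cast hmn))
  intro m n h
  rcases lt_trichotomy m n with hmn | hmn | hmn
  · exact absurd h (key m n hmn)
  · exact hmn
  · exact absurd h.symm (key n m hmn)

theorem encard_setOf_edist_le {D : ℕ} (hdeg : ∀ v, (H.neighborSet v).encard ≤ D) (v : V) (n : ℕ) :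
    {w | H.edist v w ≤ n}.encard ≤ ((D + 1) ^ n : ℕ) := by
  have hfin : ∀ v, (H.neighborSet v).Finite := fun v =>
    Set.finite_of_encard_le_coe (hdeg v)
  induction n with
  | zero =>
    simp only [edist_le_zero_iff]
    rw [show {w | v = w} = {v} from Set.ext fun w => eq_comm]
    simp
  | succ n ih =>
    have hB := finite_setOf_edist_le hfin v n
    have hcard : hB.toFinset.card ≤ (D + 1) ^ n := by
      have h := ih
      rw [hB.encard_eq_coe_toFinset_card] at h
      exact_mod_cast h
    classical
    -- The next ball is covered by the closed neighbourhoods of the points of the previous one, each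
    -- of at most `D + 1` points.
    set s : Finset V := hB.toFinset.biUnion fun w => insert w (hfin w).toFinset with hs
    have hsub : {w | H.edist v w ≤ ((n + 1 : ℕ) : ℕ∞)} ⊆ s := by
      intro x hx
      simp only [hs, Finset.coe_biUnion, Set.mem_iUnion]
      rcases edist_le_succ_iff'.1 hx with h | ⟨w, hw, h⟩
      · exact ⟨x, by simpa using h, by simp⟩
      · exact ⟨w, by simpa using hw, by simp [h]⟩
    have hle : s.card ≤ hB.toFinset.card * (D + 1) := by
      refine Finset.card_biUnion_le_card_mul _ _ _ fun w _ => (Finset.card_insert_le _ _).trans ?_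
      have h := hdeg w
      rw [(hfin w).encard_eq_coe_toFinset_card] at h
      have h' : (hfin w).toFinset.card ≤ D := by exact_mod_cast h
      omega
    refine (Set.encard_le_encard hsub).trans ?_
    rw [Set.encard_coe_eq_coe_finsetCard]
    have := hle.trans (Nat.mul_le_mul_right (D + 1) hcard)
    exact_mod_cast this

/-- The subgraph of all the edges with both endpoints in `c`. -/
def within (H : SimpleGraph V) (c : Set V) : SimpleGraph V where
  Adj u v := H.Adj u v ∧ u ∈ c ∧ v ∈ c
  symm := ⟨fun _ _ h => ⟨h.1.symm, h.2.2, h.2.1⟩⟩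
  loopless := ⟨fun v h => H.loopless.irrefl v h.1⟩

theorem within_le (H : SimpleGraph V) (c : Set V) : H.within c ≤ H := fun _ _ h => h.1

theorem IsClusterEmbedding.within {H' : SimpleGraph V'} {f : V → V'}
    (hf : IsClusterEmbedding H H' f) (c : Set V') :
    IsClusterEmbedding (H.within (f ⁻¹' c)) (H'.within c) f where
  injective := hf.injective
  adj_iff u w' := by
    simp only [SimpleGraph.within, hf.adj_iff]
    constructor
    · rintro ⟨⟨w, rfl, h⟩, h1, h2⟩
      exact ⟨w, rfl, h, h1, h2⟩
    · rintro ⟨w, rfl, h, h1, h2⟩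
      exact ⟨⟨w, rfl, h⟩, h1, h2⟩

/-- A shortest path of length at most `N` from `u` never leaves the `N`-ball of `u`, which lies in
`c`. -/
theorem edist_within_le {c : Set V} {N : ℕ} (hc : ∀ w, H.edist u w ≤ N → w ∈ c) (hn : n ≤ N)
    (h : H.edist u v ≤ n) : (H.within c).edist u v ≤ n := by
  induction n generalizing v with
  | zero => exact edist_le_zero_iff.2 (edist_le_zero_iff.1 h)
  | succ n ih =>
    rcases edist_le_succ_iff'.1 h with h' | ⟨w, hw, hadj⟩
    · exact edist_le_succ_iff'.2 (Or.inl (ih (by omega) h'))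
    · refine edist_le_succ_iff'.2 (Or.inr ⟨w, ih (by omega) hw, hadj, hc _ ?_, hc _ ?_⟩)
      · exact hw.trans (by exact_mod_cast (by omega : n ≤ N))
      · exact h.trans (by exact_mod_cast hn)

/-- A geodesic with `n` edges visits `n + 1` distinct vertices. -/
theorem le_encard_reachable (h : H.edist u v = n) : ((n + 1 : ℕ) : ℕ∞) ≤
    {w | H.Reachable u w}.encard := by
  classical
  obtain ⟨q, hq⟩ := exists_walk_of_edist_eq_coe h
  have hd : H.dist u v = n := by simp [dist, h]
  have hpath : q.IsPath := q.isPath_of_length_eq_dist (by rw [hq, hd])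
  have hsub : ((q.support.toFinset : Finset V) : Set V) ⊆ {w | H.Reachable u w} := by
    intro w hw
    simp only [List.coe_toFinset, Set.mem_ofPred_eq] at hw
    exact ⟨q.takeUntil w hw⟩
  refine le_trans ?_ (Set.encard_le_encard hsub)
  rw [Set.encard_coe_eq_coe_finsetCard, List.toFinset_card_of_nodup hpath.support_nodup,
    Walk.length_support, hq]

end SimpleGraph

/-! ### Growth of balls under expansion -/

open SimpleGraph in
-- The inner boundary of the ball `B_{n+1}` is disjoint from `B_n`, so `|B_n| ≤ (1 - α) |B_{n+1}|`;
-- iterate from `|B_0| = 1`.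
theorem one_le_mul_ncard_of_le_vertexExpansionConstant {V : Type*} {G : SimpleGraph V} {α : ℝ}
    (hα : α ≤ 1) (hfin : ∀ v, (G.neighborSet v).Finite) (hexp : α ≤ vertexExpansionConstant G)
    (v : V) (n : ℕ) : 1 ≤ (1 - α) ^ n * ({w | G.edist v w ≤ n}.ncard : ℝ) := by
  induction n with
  | zero =>
    simp only [edist_le_zero_iff]
    rw [show {w | v = w} = {v} from Set.ext fun w => eq_comm]
    simp
  | succ n ih =>
    have hB := finite_setOf_edist_le hfin v n
    have hB' := finite_setOf_edist_le hfin v (n + 1)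
    have hsub : {w | G.edist v w ≤ n} ⊆ {w | G.edist v w ≤ ((n + 1 : ℕ) : ℕ∞)} :=
      fun w hw => edist_le_succ_iff.2 (Or.inl hw)
    set K : Finset V := hB'.toFinset with hK
    have hKc : (K : Set V) = {w | G.edist v w ≤ ((n + 1 : ℕ) : ℕ∞)} := by simp [hK]
    have hne : K.Nonempty := ⟨v, by simp [hK]⟩
    have hle : α ≤ ((innerBoundary G (K : Set V)).ncard : ℝ) / (K.card : ℝ) :=
      hexp.trans (csInf_le ⟨0, by rintro _ ⟨K, _, rfl⟩; positivity⟩ ⟨K, hne, rfl⟩)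
    have hbd : innerBoundary G (K : Set V) ⊆
        {w | G.edist v w ≤ ((n + 1 : ℕ) : ℕ∞)} \ {w | G.edist v w ≤ n} := by
      rintro w ⟨hw, x, hx, hadj⟩
      refine ⟨hKc ▸ hw, fun hwn => hx ?_⟩
      rw [hKc]
      exact edist_le_succ_iff'.2 (Or.inr ⟨w, hwn, hadj⟩)
    have hcard := Set.ncard_le_ncard hbd (hB'.subset Set.sdiff_subset)
    have hdiff := Set.ncard_sdiff_add_ncard_of_subset hsub hB'
    have hKcard : K.card = {w | G.edist v w ≤ ((n + 1 : ℕ) : ℕ∞)}.ncard := by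
      rw [← hKc, Set.ncard_coe_finset]
    have hpos : (0 : ℝ) < K.card := by exact_mod_cast hne.card_pos
    rw [le_div_iff₀ hpos] at hle
    rw [← hKcard] at hdiff ⊢
    have h1 : ((innerBoundary G (K : Set V)).ncard : ℝ) +
        ({w | G.edist v w ≤ n}.ncard : ℝ) ≤ K.card := by
      exact_mod_cast (by omega : _ + _ ≤ _)
    have h2 : ({w | G.edist v w ≤ n}.ncard : ℝ) ≤ (1 - α) * K.card := by linarith
    calc 1 ≤ (1 - α) ^ n * ({w | G.edist v w ≤ n}.ncard : ℝ) := ih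
      _ ≤ (1 - α) ^ n * ((1 - α) * K.card) :=
          mul_le_mul_of_nonneg_left h2 (pow_nonneg (by linarith) n)
      _ = _ := by ring

/-! ### Hubs, seeds and roads

Given labels on the vertices of a graph, the *hubs* form a random set which is `r`-dense in the
unbounded clusters, and the *seeds* are a sparse subset of it. Every hub which is not a seed builds
a road of length at most `2 * r + 1` to a hub which is closer to the seeds, when distances are
measured by the number of hops between hubs. -/

namespace SimpleGraph

variable {V V' L : Type*} [LinearOrder L]

/-- The vertices of unbounded clusters whose label is small, or which have no vertex of small label
within distance `r`. -/
def IsHub (r : ℕ) (p : L) (H : SimpleGraph V) (U : V → L) (v : V) : Prop :=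
  H.Unbounded v ∧ (U v < p ∨ ∀ w, H.edist v w ≤ r → p ≤ U w)

/-- The vertices of unbounded clusters whose label is very small. -/
def IsSeed (δ : L) (H : SimpleGraph V) (U : V → L) (v : V) : Prop :=
  H.Unbounded v ∧ U v < δ

/-- A seed can be reached from `v` by `n` hops of length at most `2 * r + 1` between hubs. -/
def Hop (r : ℕ) (p δ : L) (H : SimpleGraph V) (U : V → L) : ℕ → V → Prop
  | 0, v => H.IsSeed δ U v
  | n + 1, v => H.IsHub r p U v ∧ ∃ w, H.edist v w ≤ ((2 * r + 1 : ℕ) : ℕ∞) ∧ Hop r p δ H U n w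

/-- `w` is a neighbour of `v` at distance at most `j` from `A`, with minimal label. -/
def IsStep (H : SimpleGraph V) (U : V → L) (A : V → Prop) (j : ℕ) (v w : V) : Prop :=
  (∃ y, H.edist w y ≤ j ∧ A y) ∧
    ∀ w', H.Adj v w' → (∃ y, H.edist w' y ≤ j ∧ A y) → U w ≤ U w'

/-- `v` lies on the path of steepest descent from `x` to `A`. -/
def OnDescent (H : SimpleGraph V) (U : V → L) (A : V → Prop) : ℕ → V → V → Prop
  | 0, x, v => x = v
  | j + 1, x, v => x = v ∨ ∃ w, H.Adj x w ∧ H.IsStep U A j x w ∧ OnDescent H U A j w v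

/-- `n + 1` is the least number of hops from `x` to a seed. -/
def IsFirstHop (r : ℕ) (p δ : L) (H : SimpleGraph V) (U : V → L) (n : ℕ) (x : V) : Prop :=
  H.Hop r p δ U (n + 1) x ∧ ∀ m ≤ n, ¬ H.Hop r p δ U m x

/-- `v` lies on the road built by `x`. -/
def OnRoad (r : ℕ) (p δ : L) (H : SimpleGraph V) (U : V → L) (x v : V) : Prop :=
  ∃ n, H.IsFirstHop r p δ U n x ∧ H.OnDescent U (H.Hop r p δ U n) (2 * r + 1) x v

/-- All the vertices on roads or within distance `N` from a seed. -/
def roadSet (N r : ℕ) (p δ : L) (H : SimpleGraph V) (U : V → L) : Set V :=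
  {v | (∃ t, H.edist v t ≤ N ∧ H.IsSeed δ U t) ∨
    ∃ x, H.edist v x ≤ ((2 * r + 1 : ℕ) : ℕ∞) ∧ H.OnRoad r p δ U x v}

variable {N r n j : ℕ} {p δ : L} {H : SimpleGraph V} {U : V → L} {A : V → Prop} {u v w x : V}

/-! #### Invariance -/

namespace IsClusterEmbedding

variable {H' : SimpleGraph V'} {f : V → V'} {U' : V' → L} {A' : V' → Prop}
  (hf : IsClusterEmbedding H H' f)
include hf

theorem isHub_iff : H'.IsHub r p U' (f v) ↔ H.IsHub r p (U' ∘ f) v := by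
  simp only [IsHub, hf.unbounded_iff, hf.forall_edist_le, Function.comp_apply]

theorem isSeed_iff : H'.IsSeed δ U' (f v) ↔ H.IsSeed δ (U' ∘ f) v := by
  simp only [IsSeed, hf.unbounded_iff, Function.comp_apply]

theorem hop_iff : H'.Hop r p δ U' n (f v) ↔ H.Hop r p δ (U' ∘ f) n v := by
  induction n generalizing v with
  | zero => exact hf.isSeed_iff
  | succ n ih => simp only [Hop, hf.isHub_iff, hf.exists_edist_le, ih]

theorem isStep_iff : H'.IsStep U' A' j (f v) (f w) ↔ H.IsStep (U' ∘ f) (A' ∘ f) j v w := by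
  simp only [IsStep, hf.forall_adj, hf.exists_edist_le, Function.comp_apply]

theorem onDescent_iff :
    H'.OnDescent U' A' j (f x) (f v) ↔ H.OnDescent (U' ∘ f) (A' ∘ f) j x v := by
  induction j generalizing x with
  | zero => exact hf.injective.eq_iff
  | succ j ih => simp only [OnDescent, hf.injective.eq_iff, hf.exists_adj, ih, hf.isStep_iff]

theorem onRoad_iff : H'.OnRoad r p δ U' (f x) (f v) ↔ H.OnRoad r p δ (U' ∘ f) x v := by
  simp only [OnRoad, IsFirstHop, hf.hop_iff, hf.onDescent_iff]
  have h : ∀ n, H'.Hop r p δ U' n ∘ f = H.Hop r p δ (U' ∘ f) n := fun n =>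
    funext fun v => propext hf.hop_iff
  simp only [h]

/-- The distance bound on the builder in `roadSet` already follows from `OnRoad.edist_le`. It is
stated there so that the quantifier over builders is a bounded one and transfers along `f`. -/
theorem mem_roadSet_iff : f v ∈ H'.roadSet N r p δ U' ↔ v ∈ H.roadSet N r p δ (U' ∘ f) := by
  simp only [roadSet, Set.mem_ofPred_eq, hf.exists_edist_le, hf.isSeed_iff, hf.onRoad_iff]

end IsClusterEmbedding

/-! #### Density and connectedness -/

theorem IsSeed.isHub (hδ : δ ≤ p) (h : H.IsSeed δ U v) : H.IsHub r p U v :=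
  ⟨h.1, Or.inl (h.2.trans_le hδ)⟩

theorem Hop.isHub (hδ : δ ≤ p) (h : H.Hop r p δ U n v) : H.IsHub r p U v := by
  cases n with
  | zero => exact IsSeed.isHub hδ h
  | succ n => exact h.1

/-- Either some label within distance `r` is small, and its vertex is a hub, or there is none and
`v` itself is one. -/
theorem Unbounded.exists_isHub (hv : H.Unbounded v) : ∃ q, H.edist v q ≤ r ∧ H.IsHub r p U q := by
  by_cases h : ∃ w, H.edist v w ≤ r ∧ U w < p
  · obtain ⟨w, hw, hp⟩ := h
    exact ⟨w, hw, hv.of_edist_le hw, Or.inl hp⟩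
  · push Not at h
    exact ⟨v, by simp, hv, Or.inr h⟩

/-- Walk from `v` to the seed and pick a hub within `r` of each vertex on the way. Hubs picked for
consecutive vertices are at distance at most `r + 1 + r`, which is why hops have length `2 * r + 1`.
-/
theorem exists_edist_le_hop {m : ℕ} {t : V} (ht : H.IsSeed δ U t)
    (h : H.edist v t ≤ m) : ∃ q, H.edist v q ≤ r ∧ ∃ n, H.Hop r p δ U n q := by
  induction m generalizing v with
  | zero =>
    obtain rfl := edist_le_zero_iff.1 h
    exact ⟨v, by simp, 0, ht⟩
  | succ m ih =>
    rcases edist_le_succ_iff.1 h with h' | ⟨w, hw, h'⟩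
    · exact ih h'
    · obtain ⟨q', hq', n, hn⟩ := ih h'
      have hv : H.Unbounded v := ht.1.of_edist_le (by rwa [edist_comm])
      obtain ⟨q, hq, hhub⟩ := hv.exists_isHub (r := r) (p := p) (U := U)
      refine ⟨q, hq, n + 1, hhub, q', ?_, hn⟩
      have h1 : H.edist v q' ≤ ((r + 1 : ℕ) : ℕ∞) := edist_le_succ_iff.2 (Or.inr ⟨w, hw, hq'⟩)
      rw [edist_comm] at hq
      have h2 := edist_le_add hq h1
      rwa [show r + (r + 1) = 2 * r + 1 by omega] at h2

theorem IsHub.exists_hop {m : ℕ} {t : V} (ht : H.IsSeed δ U t)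
    (hx : H.IsHub r p U x) (h : H.edist x t ≤ m) : ∃ n, H.Hop r p δ U n x := by
  obtain ⟨q, hq, n, hn⟩ := exists_edist_le_hop (r := r) ht h
  exact ⟨n + 1, hx, q, hq.trans (by exact_mod_cast (by omega : r ≤ 2 * r + 1)), hn⟩

theorem OnDescent.refl (j : ℕ) (x : V) : H.OnDescent U A j x x := by
  cases j with
  | zero => rfl
  | succ j => exact Or.inl rfl

theorem OnDescent.edist_le (h : H.OnDescent U A j x v) : H.edist x v ≤ j := by
  induction j generalizing x with
  | zero => exact edist_le_zero_iff.2 h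
  | succ j ih =>
    rcases h with rfl | ⟨w, hw, -, h⟩
    · simp
    · exact edist_le_succ_iff.2 (Or.inr ⟨w, hw, ih h⟩)

theorem OnRoad.edist_le (h : H.OnRoad r p δ U x v) : H.edist x v ≤ ((2 * r + 1 : ℕ) : ℕ∞) :=
  let ⟨_, _, h⟩ := h
  h.edist_le

theorem OnRoad.mem_roadSet (h : H.OnRoad r p δ U x v) : v ∈ H.roadSet N r p δ U :=
  Or.inr ⟨x, by rw [edist_comm]; exact h.edist_le, h⟩

theorem OnRoad.isHub (h : H.OnRoad r p δ U x v) : H.IsHub r p U x :=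
  let ⟨_, h, _⟩ := h
  h.1.1

theorem IsSeed.mem_roadSet {t : V} (ht : H.IsSeed δ U t) (h : H.edist t v ≤ N) :
    v ∈ H.roadSet N r p δ U :=
  Or.inl ⟨t, by rwa [edist_comm], ht⟩

/-- A vertex which can hop to a seed is a seed or builds a road. -/
theorem Hop.isSeed_or_isFirstHop (h : H.Hop r p δ U n v) :
    H.IsSeed δ U v ∨ ∃ k < n, H.IsFirstHop r p δ U k v := by
  classical
  have hex : ∃ m, H.Hop r p δ U m v := ⟨n, h⟩
  have h1 := Nat.find_spec hex
  have h2 := Nat.find_le (n := n) (hn := h) (h := hex)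
  have h3 : ∀ m < Nat.find hex, ¬ H.Hop r p δ U m v := fun m hm => Nat.find_min hex hm
  generalize Nat.find hex = k at h1 h2 h3
  cases k with
  | zero => exact Or.inl h1
  | succ k => exact Or.inr ⟨k, by omega, h1, fun m hm => h3 m (by omega)⟩

theorem Hop.mem_roadSet (h : H.Hop r p δ U n v) : v ∈ H.roadSet N r p δ U := by
  rcases h.isSeed_or_isFirstHop with h | ⟨k, -, h⟩
  · exact h.mem_roadSet (by simp)
  · exact OnRoad.mem_roadSet ⟨k, h, OnDescent.refl _ _⟩

/-- The roads are `r`-dense in every cluster with a seed. -/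
theorem Unbounded.exists_mem_roadSet {t : V} (hv : H.Unbounded v)
    (ht : H.IsSeed δ U t) (hvt : H.Reachable v t) :
    ∃ w, H.edist v w ≤ r ∧ w ∈ H.roadSet N r p δ U := by
  obtain ⟨q, hq, hhub⟩ := hv.exists_isHub (r := r) (p := p) (U := U)
  have hqt : H.Reachable q t :=
    (reachable_iff_exists_edist_le.2 ⟨r, hq⟩).symm.trans hvt
  obtain ⟨m, hm⟩ := reachable_iff_exists_edist_le.1 hqt
  obtain ⟨n, hn⟩ := hhub.exists_hop ht hm
  exact ⟨q, hq, hn.mem_roadSet⟩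

theorem OnDescent.reachable_within {c : Set V} (hc : ∀ w, H.OnDescent U A j x w → w ∈ c)
    (h : H.OnDescent U A j x v) : (H.within c).Reachable x v := by
  induction j generalizing x with
  | zero =>
    obtain rfl : x = v := h
    exact Reachable.refl _
  | succ j ih =>
    rcases h with rfl | ⟨w, hw, hs, h⟩
    · exact Reachable.refl _
    · have hadj : (H.within c).Adj x w := ⟨hw, hc x (OnDescent.refl _ _),
        hc w (Or.inr ⟨w, hw, hs, OnDescent.refl _ _⟩)⟩
      exact hadj.reachable.trans (ih (fun y hy => hc y (Or.inr ⟨w, hw, hs, hy⟩)) h)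

/-- Away from `A`, some neighbour is one step nearer to `A`, and local finiteness provides one of
minimal label. Ties are harmless here; distinct labels matter only for bounding the length of the
road. -/
theorem exists_onDescent (hfin : ∀ v, (H.neighborSet v).Finite) (h : ∃ y, H.edist x y ≤ j ∧ A y) :
    ∃ y, A y ∧ H.OnDescent U A j x y := by
  induction j generalizing x with
  | zero =>
    obtain ⟨y, hy, hA⟩ := h
    exact ⟨y, hA, edist_le_zero_iff.1 hy⟩
  | succ j ih =>
    by_cases hx : A x
    · exact ⟨x, hx, Or.inl rfl⟩
    · have hne : ∃ w, H.Adj x w ∧ ∃ y, H.edist w y ≤ j ∧ A y := by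
        by_contra! hcon
        obtain ⟨y, hy, hA⟩ := h
        -- A target already within distance `j` differs from `x`, so the first edge of a path to it
        -- leads to a suitable neighbour as well.
        have : ∀ i : ℕ, i ≤ j → ¬ H.edist x y ≤ i := by
          intro i hi hxy
          cases i with
          | zero => exact hx (edist_le_zero_iff.1 hxy ▸ hA)
          | succ i =>
            obtain ⟨q, hq⟩ := edist_le_coe_iff_exists_walk.1 hxy
            cases q with
            | nil => exact hx hA
            | cons hadj q' =>
              refine hcon _ hadj y (edist_le_coe_iff_exists_walk.2 ⟨q', ?_⟩) hA
              simp only [Walk.length_cons] at hq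
              omega
        rcases edist_le_succ_iff.1 hy with h' | ⟨w, hw, h'⟩
        · exact this j le_rfl h'
        · exact hcon w hw y h' hA
      have hfin' : {w | H.Adj x w ∧ ∃ y, H.edist w y ≤ j ∧ A y}.Finite :=
        (hfin x).subset fun w hw => hw.1
      obtain ⟨w, ⟨hw, hwA⟩, hmin⟩ := Set.exists_min_image _ U hfin' hne
      obtain ⟨y, hA, hy⟩ := ih hwA
      exact ⟨y, hA, Or.inr ⟨w, hw, ⟨hwA, fun w' h1 h2 => hmin w' ⟨h1, h2⟩⟩, hy⟩⟩

/-- Strong induction on the number of hops: the road of a vertex whose least number of hops is `k +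
1` contains a vertex that needs `k` hops, and `k < n`. -/
theorem Hop.exists_reachable_within (hfin : ∀ v, (H.neighborSet v).Finite)
    (h : H.Hop r p δ U n v) :
    ∃ t, H.IsSeed δ U t ∧ (H.within (H.roadSet N r p δ U)).Reachable v t := by
  induction n using Nat.strong_induction_on generalizing v with
  | _ n ih =>
    rcases h.isSeed_or_isFirstHop with h | ⟨k, hk, h⟩
    · exact ⟨v, h, Reachable.refl _⟩
    · obtain ⟨y, hy, hd⟩ := exists_onDescent (U := U) hfin h.1.2
      obtain ⟨t, ht, hyt⟩ := ih k hk hy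
      exact ⟨t, ht, (hd.reachable_within fun w hw => OnRoad.mem_roadSet ⟨k, h, hw⟩).trans hyt⟩

/-- Every vertex of a road is connected by roads to a seed, and so to a vertex at distance `N`
from that seed. -/
theorem exists_reachable_within_of_mem_roadSet (hfin : ∀ v, (H.neighborSet v).Finite)
    (hv : v ∈ H.roadSet N r p δ U) :
    ∃ t, (H.within (H.roadSet N r p δ U)).Reachable v t ∧
      ∃ w, (H.within (H.roadSet N r p δ U)).edist t w = N := by
  have hseed : ∃ t, H.IsSeed δ U t ∧ (H.within (H.roadSet N r p δ U)).Reachable v t := by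
    rcases hv with ⟨t, ht, hs⟩ | ⟨x, -, n, hn, hd⟩
    · refine ⟨t, hs, Reachable.symm (reachable_iff_exists_edist_le.2 ⟨N, ?_⟩)⟩
      rw [edist_comm] at ht
      exact edist_within_le (fun w hw => hs.mem_roadSet hw) le_rfl ht
    · obtain ⟨t, ht, hxt⟩ := hn.1.exists_reachable_within (N := N) hfin
      exact ⟨t, ht, (hd.reachable_within fun w hw => OnRoad.mem_roadSet ⟨n, hn, hw⟩).symm.trans hxt⟩
  obtain ⟨t, hs, hvt⟩ := hseed
  refine ⟨t, hvt, ?_⟩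
  have hball : ∀ w, H.edist t w ≤ N → w ∈ H.roadSet N r p δ U := fun w hw => hs.mem_roadSet hw
  clear hvt
  generalize H.roadSet N r p δ U = c at hball
  cases N with
  | zero => exact ⟨t, by simp⟩
  | succ n =>
    -- The seed lies in an unbounded cluster, so some `w` is at distance exactly `n + 1`. A geodesic
    -- to it runs inside the closed ball of the seed, and passing to a subgraph cannot shorten
    -- distances.
    obtain ⟨w, hw, hw'⟩ := hs.1 n
    refine ⟨w, le_antisymm (edist_within_le hball le_rfl hw) ?_⟩
    by_contra! hlt
    refine hw' ((edist_anti (H.within_le c)).trans ?_)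
    exact_mod_cast Order.le_of_lt_add_one (by exact_mod_cast hlt)

/-! #### The length of a road -/

/-- Distinct labels make the minimising neighbour unique, so the descent is a single path with at
most `j` edges. -/
theorem encard_onDescent_le (hU : Function.Injective U) (j : ℕ) (x : V) :
    {v | H.OnDescent U A j x v}.encard ≤ ((j + 1 : ℕ) : ℕ∞) := by
  induction j generalizing x with
  | zero =>
    rw [show {v | H.OnDescent U A 0 x v} = {x} from Set.ext fun w => eq_comm]
    simp
  | succ j ih =>
    by_cases h : ∃ w, H.Adj x w ∧ H.IsStep U A j x w
    · obtain ⟨w, hw, hs⟩ := h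
      have hsub : {v | H.OnDescent U A (j + 1) x v} ⊆ insert x {v | H.OnDescent U A j w v} := by
        rintro v (rfl | ⟨w', hw', hs', h⟩)
        · exact Or.inl rfl
        · obtain rfl : w = w' := hU (le_antisymm (hs.2 w' hw' hs'.1) (hs'.2 w hw hs.1))
          exact Or.inr h
      refine (Set.encard_le_encard hsub).trans ((Set.encard_insert_le _ _).trans ?_)
      push_cast
      exact add_le_add_left (by exact_mod_cast ih w) 1
    · have hsub : {v | H.OnDescent U A (j + 1) x v} ⊆ {x} := by
        rintro v (rfl | ⟨w, hw, hs, -⟩)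
        · rfl
        · exact absurd ⟨w, hw, hs⟩ h
      refine (Set.encard_le_encard hsub).trans ?_
      rw [Set.encard_singleton]
      exact_mod_cast (by omega : 1 ≤ j + 1 + 1)

/-- The least number of hops determines the target set, so a builder has only one descent, with at
most `2 * r + 1` edges. -/
theorem encard_onRoad_le (hU : Function.Injective U) (x : V) :
    {v | H.OnRoad r p δ U x v}.encard ≤ ((2 * r + 2 : ℕ) : ℕ∞) := by
  by_cases h : ∃ n, H.IsFirstHop r p δ U n x
  · obtain ⟨n, hn⟩ := h
    refine (Set.encard_le_encard ?_).trans
      (encard_onDescent_le (H := H) (A := H.Hop r p δ U n) hU (2 * r + 1) x)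
    rintro v ⟨m, hm, hv⟩
    have : m = n := by
      rcases lt_trichotomy m n with h | h | h
      · exact absurd hm.1 (hn.2 _ h)
      · exact h
      · exact absurd hn.1 (hm.2 _ h)
    exact this ▸ hv
  · rw [show {v | H.OnRoad r p δ U x v} = ∅ from
      Set.eq_empty_of_forall_notMem fun v ⟨n, hn, _⟩ => h ⟨n, hn⟩]
    simp

/-! #### Measurability -/

section Measurability

variable {Ω : Type*} [MeasurableSpace Ω] [Countable V] {H : Ω → SimpleGraph V} {U : Ω → V → L}

theorem measurable_edist_le (hH : ∀ u v, Measurable fun a => (H a).Adj u v) (n : ℕ) (u v : V) :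
    Measurable fun a => (H a).edist u v ≤ n := by
  induction n generalizing u with
  | zero => simp only [edist_le_zero_iff]; exact measurable_const
  | succ n ih =>
    simp only [edist_le_succ_iff]
    exact (ih u).or (Measurable.exists fun w => (hH u w).and (ih w))

theorem measurable_unbounded (hH : ∀ u v, Measurable fun a => (H a).Adj u v) (v : V) :
    Measurable fun a => (H a).Unbounded v :=
  Measurable.forall fun n => Measurable.exists fun w =>
    (measurable_edist_le hH (n + 1) v w).and (measurable_edist_le hH n v w).not

variable [MeasurableSpace L] [TopologicalSpace L] [OpensMeasurableSpace L] [OrderClosedTopology L]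
  [SecondCountableTopology L]

theorem measurable_isHub (hH : ∀ u v, Measurable fun a => (H a).Adj u v)
    (hU : ∀ v, Measurable fun a => U a v) (r : ℕ) (p : L) (v : V) :
    Measurable fun a => (H a).IsHub r p (U a) v := by
  refine (measurable_unbounded hH v).and (Measurable.or ?_ (Measurable.forall fun w =>
    (measurable_edist_le hH r v w).imp ?_))
  · exact (measurableSet_lt (hU v) measurable_const).mem
  · exact (measurableSet_le measurable_const (hU w)).mem

theorem measurable_isSeed (hH : ∀ u v, Measurable fun a => (H a).Adj u v)
    (hU : ∀ v, Measurable fun a => U a v) (δ : L) (v : V) :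
    Measurable fun a => (H a).IsSeed δ (U a) v :=
  (measurable_unbounded hH v).and (measurableSet_lt (hU v) measurable_const).mem

theorem measurable_hop (hH : ∀ u v, Measurable fun a => (H a).Adj u v)
    (hU : ∀ v, Measurable fun a => U a v) (r : ℕ) (p δ : L) (n : ℕ) (v : V) :
    Measurable fun a => (H a).Hop r p δ (U a) n v := by
  induction n generalizing v with
  | zero => exact measurable_isSeed hH hU δ v
  | succ n ih =>
    exact (measurable_isHub hH hU r p v).and (Measurable.exists fun w =>
      (measurable_edist_le hH (2 * r + 1) v w).and (ih w))

theorem measurable_onDescent (hH : ∀ u v, Measurable fun a => (H a).Adj u v)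
    (hU : ∀ v, Measurable fun a => U a v) {A : Ω → V → Prop}
    (hA : ∀ v, Measurable fun a => A a v) (j : ℕ) (x v : V) :
    Measurable fun a => (H a).OnDescent (U a) (A a) j x v := by
  induction j generalizing x with
  | zero => exact measurable_const
  | succ j ih =>
    have hnear : ∀ w, Measurable fun a => ∃ y, (H a).edist w y ≤ j ∧ A a y := fun w =>
      Measurable.exists fun y => (measurable_edist_le hH j w y).and (hA y)
    refine Measurable.or measurable_const (Measurable.exists fun w => (hH x w).and
      (((hnear w).and (Measurable.forall fun w' => (hH x w').imp ((hnear w').imp ?_))).and (ih w)))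
    exact (measurableSet_le (hU w) (hU w')).mem

theorem measurable_onRoad (hH : ∀ u v, Measurable fun a => (H a).Adj u v)
    (hU : ∀ v, Measurable fun a => U a v) (r : ℕ) (p δ : L) (x v : V) :
    Measurable fun a => (H a).OnRoad r p δ (U a) x v :=
  Measurable.exists fun n => ((measurable_hop hH hU r p δ (n + 1) x).and
    (Measurable.forall fun m => measurable_const.imp (measurable_hop hH hU r p δ m x).not)).and
    (measurable_onDescent hH hU (measurable_hop hH hU r p δ n) (2 * r + 1) x v)

theorem measurable_mem_roadSet (hH : ∀ u v, Measurable fun a => (H a).Adj u v)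
    (hU : ∀ v, Measurable fun a => U a v) (N r : ℕ) (p δ : L) (v : V) :
    Measurable fun a => v ∈ (H a).roadSet N r p δ (U a) :=
  (Measurable.exists fun t => (measurable_edist_le hH N v t).and (measurable_isSeed hH hU δ t)).or
    (Measurable.exists fun x => (measurable_edist_le hH (2 * r + 1) v x).and
      (measurable_onRoad hH hU r p δ x v))

end Measurability

end SimpleGraph

open scoped unitInterval

/-! ### Measurability of concrete marked graphs -/

namespace RootedMarkedGraph

variable {X : Type*} {k : ℕ}

theorem measurable_iff [MeasurableSpace X] {Ω : Type*} [MeasurableSpace Ω]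
    {f : Ω → RootedMarkedGraph X k} :
    Measurable f ↔ (∀ v, Measurable fun a => v ∈ (f a).graph.verts) ∧
      (∀ u v, Measurable fun a => (f a).graph.Adj u v) ∧
      (∀ i, Measurable fun a => ((f a).root i : ℕ)) ∧
      (∀ v, Measurable fun a => (f a).vmark v) ∧ ∀ e, Measurable fun a => (f a).emark e := by
  rw [measurable_comap_iff]
  constructor
  · intro h
    have h1 := measurable_fst.comp h
    have h2 := measurable_fst.comp (measurable_snd.comp h)
    have h3 := measurable_fst.comp (measurable_snd.comp (measurable_snd.comp h))
    have h4 := measurable_fst.comp (measurable_snd.comp (measurable_snd.comp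
      (measurable_snd.comp h)))
    have h5 := measurable_snd.comp (measurable_snd.comp (measurable_snd.comp
      (measurable_snd.comp h)))
    exact ⟨fun v => (measurable_pi_apply v).comp h1,
      fun u v => (measurable_pi_apply v).comp ((measurable_pi_apply u).comp h2),
      fun i => (measurable_pi_apply i).comp h3, fun v => (measurable_pi_apply v).comp h4,
      fun e => (measurable_pi_apply e).comp h5⟩
  · rintro ⟨h1, h2, h3, h4, h5⟩
    exact (measurable_pi_lambda _ h1).prodMk ((measurable_pi_lambda _ fun u =>
      measurable_pi_lambda _ (h2 u)).prodMk ((measurable_pi_lambda _ h3).prodMk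
      ((measurable_pi_lambda _ h4).prodMk (measurable_pi_lambda _ h5))))

section

variable [MeasurableSpace X]

theorem measurable_mem_verts (v : ℕ) :
    Measurable fun g : RootedMarkedGraph X k => v ∈ g.graph.verts :=
  (measurable_iff.1 measurable_id).1 v

theorem measurable_adj (u v : ℕ) :
    Measurable fun g : RootedMarkedGraph X k => g.graph.Adj u v :=
  (measurable_iff.1 measurable_id).2.1 u v

theorem measurable_root (i : Fin k) :
    Measurable fun g : RootedMarkedGraph X k => (g.root i : ℕ) :=
  (measurable_iff.1 measurable_id).2.2.1 i

theorem measurable_vmark (v : ℕ) : Measurable fun g : RootedMarkedGraph X k => g.vmark v :=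
  (measurable_iff.1 measurable_id).2.2.2.1 v

theorem measurable_emark (e : Sym2 ℕ) :
    Measurable fun g : RootedMarkedGraph X k => g.emark e :=
  (measurable_iff.1 measurable_id).2.2.2.2 e

theorem measurable_withRoots_of {Ω : Type*} [MeasurableSpace Ω] {g : Ω → RootedMarkedGraph X k}
    {u v : ∀ a, (g a).graph.verts} (hg : Measurable g) (hu : Measurable fun a => (u a : ℕ))
    (hv : Measurable fun a => (v a : ℕ)) : Measurable fun a => (g a).withRoots (u a) (v a) := by
  obtain ⟨h1, h2, -, h4, h5⟩ := measurable_iff.1 hg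
  refine measurable_iff.2 ⟨h1, h2, fun i => ?_, h4, h5⟩
  fin_cases i
  · exact hu
  · exact hv

/-- The index set varies with `g`; extending the summand by zero gives a sum over the fixed
countable set `ℕ`. -/
theorem measurable_tsum_verts {W : ∀ g : RootedMarkedGraph X k, g.graph.verts → ℝ≥0∞}
    (hW : ∀ o, Measurable fun g : {g : RootedMarkedGraph X k | o ∈ g.graph.verts} =>
      W g ⟨o, g.2⟩) : Measurable fun g => ∑' o, W g o := by
  classical
  have h : ∀ g : RootedMarkedGraph X k, ∑' o, W g o =
      ∑' o : ℕ, if ho : o ∈ g.graph.verts then W g ⟨o, ho⟩ else 0 := by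
    intro g
    rw [← tsum_subtype_eq_of_support_subset (s := g.graph.verts)]
    · exact tsum_congr fun o => by rw [dif_pos o.2]
    · intro o ho
      by_contra hcon
      exact ho (dif_neg hcon)
  simp only [h]
  refine Measurable.tsum fun o => ?_
  exact Measurable.dite (hW o) measurable_const (measurable_mem_verts o).setOf

end

end RootedMarkedGraph

namespace GraphClass

theorem holds_mk_iff {X : Type*} {k : ℕ} {P : RootedMarkedGraph X k → Prop}
    (hP : ∀ a b, RootedMarkedGraph.Isomorphic a b → P a → P b) (g : RootedMarkedGraph X k) :
    (mk g).Holds P ↔ P g :=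
  ⟨fun h => h g rfl, fun h _ hb => hP _ _ (Setoid.symm (Quotient.exact hb)) h⟩

variable {X : Type*} [MeasurableSpace X] {k : ℕ}

theorem measurable_mk : Measurable (mk : RootedMarkedGraph X k → GraphClass X k) :=
  measurable_quotient_mk''

theorem measurable_of_comp_mk {β : Type*} [MeasurableSpace β] {f : GraphClass X k → β}
    (hf : Measurable (f ∘ mk)) : Measurable f :=
  fun _ hs => hf hs

theorem measurable_massOut {f : GraphClass X 2 → ℝ≥0∞} (hf : Measurable f) :
    Measurable (massOut f) := by
  refine measurable_of_comp_mk (RootedMarkedGraph.measurable_tsum_verts fun o => ?_)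
  exact hf.comp (measurable_mk.comp (RootedMarkedGraph.measurable_withRoots_of
    measurable_subtype_coe ((RootedMarkedGraph.measurable_root 0).comp measurable_subtype_coe)
    measurable_const))

theorem measurable_massIn {f : GraphClass X 2 → ℝ≥0∞} (hf : Measurable f) :
    Measurable (massIn f) := by
  refine measurable_of_comp_mk (RootedMarkedGraph.measurable_tsum_verts fun o => ?_)
  exact hf.comp (measurable_mk.comp (RootedMarkedGraph.measurable_withRoots_of
    measurable_subtype_coe measurable_const
    ((RootedMarkedGraph.measurable_root 0).comp measurable_subtype_coe)))

end GraphClass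

/-! ### Independent uniform labels -/

/-- The law of independent uniform labels. -/
noncomputable def labelMeasure (ι : Type*) : Measure (ι → I) :=
  Measure.infinitePi fun _ => volume

instance (ι : Type*) : IsProbabilityMeasure (labelMeasure ι) :=
  inferInstanceAs (IsProbabilityMeasure (Measure.infinitePi _))

theorem labelMeasure_map_comp {ι κ : Type*} {τ : κ → ι} (hτ : Function.Injective τ) :
    (labelMeasure ι).map (fun U => U ∘ τ) = labelMeasure κ := by
  classical
  have hm : Measurable fun U : ι → I => U ∘ τ :=
    measurable_pi_lambda _ fun i => measurable_pi_apply (τ i)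
  refine Measure.eq_infinitePi _ fun s t ht => ?_
  rw [Measure.map_apply hm (MeasurableSet.pi s.countable_toSet fun i _ => ht i)]
  -- Extend the box by the whole interval at the indices outside the range of `τ`; these contribute
  -- a factor `1`.
  set t' : ι → Set I := fun i => if h : ∃ j, τ j = i then t h.choose else Set.univ with ht'
  have htτ : ∀ j, t' (τ j) = t j := by
    intro j
    have h : ∃ j', τ j' = τ j := ⟨j, rfl⟩
    simp only [ht', dif_pos h]
    rw [hτ h.choose_spec]
  have hpre : (fun U : ι → I => U ∘ τ) ⁻¹' (Set.pi s t) =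
      Set.pi (s.map ⟨τ, hτ⟩ : Finset ι) t' := by
    ext U
    simp [Set.mem_pi, htτ]
  rw [hpre, labelMeasure, Measure.infinitePi_pi]
  · simp [htτ]
  · intro i hi
    obtain ⟨j, -, rfl⟩ := Finset.mem_map.1 hi
    rw [Function.Embedding.coeFn_mk, htτ]
    exact ht j

theorem lintegral_labelMeasure_comp {ι κ : Type*} {τ : κ → ι} (hτ : Function.Injective τ)
    {f : (κ → I) → ℝ≥0∞} (hf : Measurable f) :
    ∫⁻ U, f (U ∘ τ) ∂labelMeasure ι = ∫⁻ U, f U ∂labelMeasure κ := by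
  rw [← labelMeasure_map_comp hτ, lintegral_map hf]
  exact measurable_pi_lambda _ fun i => measurable_pi_apply (τ i)

theorem ae_injective_labelMeasure {ι : Type*} [Countable ι] :
    ∀ᵐ U ∂labelMeasure ι, Function.Injective U := by
  have h : ∀ i j : ι, i ≠ j → ∀ᵐ U ∂labelMeasure ι, U i ≠ U j := by
    intro i j hij
    have hm : Measurable fun U : ι → I => (U i, U j) := by fun_prop
    have hd : MeasurableSet {z : I × I | z.1 = z.2} := measurableSet_eq_fun measurable_fst
      measurable_snd
    have h0 : (labelMeasure ι).map (fun U => (U i, U j)) {z : I × I | z.1 = z.2} = 0 := by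
      rw [labelMeasure, Measure.infinitePi_map_eval_prod hij, Measure.measure_prod_null hd]
      filter_upwards with a
      exact (congrArg volume (show Prod.mk a ⁻¹' {z : I × I | z.1 = z.2} = {a} from
        Set.ext fun b => eq_comm)).trans (measure_singleton a)
    rw [Measure.map_apply hm hd] at h0
    rw [ae_iff]
    simpa using h0
  have h' : ∀ᵐ U ∂labelMeasure ι, ∀ i j : ι, i ≠ j → U i ≠ U j :=
    ae_all_iff.2 fun i => ae_all_iff.2 fun j => by
      by_cases hij : i = j
      · simp [hij]
      · filter_upwards [h i j hij] with U hU _ using hU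
  filter_upwards [h'] with U hU i j hij
  by_contra hne
  exact hU i j hne hij

/-! ### Averages over labels of isomorphism-invariant functionals -/

namespace RootedMarkedGraph

variable {X β : Type*} {k : ℕ}

/-- The functional `Ψ` of labelled marked graphs is invariant under isomorphism. -/
def LabelInvariant (Ψ : RootedMarkedGraph X k → (ℕ → I) → β) : Prop :=
  ∀ (a b : RootedMarkedGraph X k) (e : a.graph.coe ≃g b.graph.coe),
    (∀ i, e (a.root i) = b.root i) →
    (∀ v : a.graph.verts, b.vmark (e v) = a.vmark v) →
    (∀ u v : a.graph.verts, a.graph.Adj u v → b.emark s(↑(e u), ↑(e v)) = a.emark s(↑u, ↑v)) →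
    ∀ U U' : ℕ → I, (∀ v : a.graph.verts, U' (e v) = U v) → Ψ a U = Ψ b U'

theorem LabelInvariant.comp {γ : Type*} {Ψ : RootedMarkedGraph X k → (ℕ → I) → β}
    (hΨ : LabelInvariant Ψ) (φ : β → γ) : LabelInvariant fun g U => φ (Ψ g U) :=
  fun a b e h1 h2 h3 U U' hU => congrArg φ (hΨ a b e h1 h2 h3 U U' hU)

/-- An isomorphism matches the vertex sets only and need not extend to a permutation of `ℕ`. Couple
the labels on `ℕ ⊕ ℕ`: `a` reads the left copy, while `b` reads the left copy through the inverse
isomorphism at its vertices and the right copy elsewhere. Both readings are injective, hence have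
the law of independent uniform labels, and they agree at matched vertices. -/
theorem LabelInvariant.lintegral_eq {Ψ : RootedMarkedGraph X k → (ℕ → I) → ℝ≥0∞}
    (hΨ : LabelInvariant Ψ) (hm : ∀ g, Measurable (Ψ g)) {a b : RootedMarkedGraph X k}
    (h : Isomorphic a b) :
    ∫⁻ U, Ψ a U ∂labelMeasure ℕ = ∫⁻ U, Ψ b U ∂labelMeasure ℕ := by
  classical
  obtain ⟨e, h1, h2, h3⟩ := h
  set τ : ℕ → ℕ ⊕ ℕ := fun w =>
    if hw : w ∈ b.graph.verts then Sum.inl (e.symm ⟨w, hw⟩ : ℕ) else Sum.inr w with hτ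
  have hτi : Function.Injective τ := by
    intro w w' hww
    by_cases hw : w ∈ b.graph.verts <;> by_cases hw' : w' ∈ b.graph.verts <;>
      simp only [hτ, hw, hw', dif_pos, dif_neg, not_false_eq_true, Sum.inl.injEq, Sum.inr.injEq,
        reduceCtorEq] at hww
    · simpa using e.symm.injective (Subtype.ext hww)
    · exact hww
  rw [← lintegral_labelMeasure_comp (ι := ℕ ⊕ ℕ) Sum.inl_injective (hm a),
    ← lintegral_labelMeasure_comp hτi (hm b)]
  refine lintegral_congr fun U => hΨ a b e h1 h2 h3 _ _ fun v => ?_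
  simp only [Function.comp_apply, hτ, dif_pos (e v).2, Subtype.coe_eta,
    RelIso.symm_apply_apply]

end RootedMarkedGraph

namespace GraphClass

variable {X Y : Type*} [MeasurableSpace X] [MeasurableSpace Y] {k : ℕ}

/-- A functional of labelled marked graphs, averaged over independent uniform labels. -/
noncomputable def average (Ψ : RootedMarkedGraph X k → (ℕ → I) → ℝ≥0∞)
    (hΨ : RootedMarkedGraph.LabelInvariant Ψ) (hm : Measurable (Function.uncurry Ψ)) :
    GraphClass X k → ℝ≥0∞ :=
  Quotient.lift (fun g => ∫⁻ U, Ψ g U ∂labelMeasure ℕ)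
    fun _ _ h => hΨ.lintegral_eq (fun _ => hm.comp measurable_prodMk_left) h

theorem measurable_average {Ψ : RootedMarkedGraph X k → (ℕ → I) → ℝ≥0∞}
    (hΨ : RootedMarkedGraph.LabelInvariant Ψ) (hm : Measurable (Function.uncurry Ψ)) :
    Measurable (average Ψ hΨ hm) :=
  measurable_of_comp_mk hm.lintegral_prod_right'

/-- The law of the random marked graph obtained from an isomorphism class by a functional of
independent uniform labels. -/
noncomputable def randomize (T : RootedMarkedGraph X k → (ℕ → I) → GraphClass Y k)
    (hT : RootedMarkedGraph.LabelInvariant T) (hm : Measurable (Function.uncurry T)) :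
    GraphClass X k → Measure (GraphClass Y k) :=
  Quotient.lift (fun g => (labelMeasure ℕ).map (T g)) fun a b h => by
    have hTm : ∀ g, Measurable (T g) := fun g => hm.comp measurable_prodMk_left
    refine Measure.ext fun s hs => ?_
    have hind : Measurable (s.indicator (1 : GraphClass Y k → ℝ≥0∞)) :=
      measurable_one.indicator hs
    rw [← lintegral_indicator_one hs, ← lintegral_indicator_one hs,
      lintegral_map hind (hTm a), lintegral_map hind (hTm b)]
    exact (hT.comp (s.indicator (1 : GraphClass Y k → ℝ≥0∞))).lintegral_eq
      (fun g => hind.comp (hTm g)) h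

theorem measurable_randomize {T : RootedMarkedGraph X k → (ℕ → I) → GraphClass Y k}
    (hT : RootedMarkedGraph.LabelInvariant T) (hm : Measurable (Function.uncurry T)) :
    Measurable (randomize T hT hm) := by
  refine measurable_of_comp_mk (Measure.measurable_of_measurable_coe _ fun s hs => ?_)
  have h : ∀ g, (randomize T hT hm ∘ mk) g s =
      labelMeasure ℕ (Prod.mk g ⁻¹' (Function.uncurry T ⁻¹' s)) := fun g =>
    Measure.map_apply (hm.comp measurable_prodMk_left) hs
  simp only [h]
  exact measurable_measure_prodMk_left (hm hs)

end GraphClass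

/-! ### Site percolations which are factors of independent labels -/

namespace RootedMarkedGraph

variable {X : Type*} {k : ℕ}

open Classical in
/-- The marked graph with the additional site percolation for which the set of closed vertices
is `c`. -/
noncomputable def siteMark (g : RootedMarkedGraph X k) (c : Set ℕ) :
    RootedMarkedGraph (X × Bool) k where
  graph := g.graph
  connected := g.connected
  locallyFinite := g.locallyFinite
  vmark v := (g.vmark v, decide (v ∉ c))
  emark e := (g.emark e, decide (∀ v ∈ e, v ∉ c))
  root := g.root

variable {g : RootedMarkedGraph X k} {c : Set ℕ}

theorem siteMark_vOpen_iff {v : ℕ} : (g.siteMark c).VOpen v ↔ v ∉ c := by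
  simp [VOpen, siteMark]

theorem siteMark_eOpen_iff {u v : ℕ} : (g.siteMark c).EOpen s(u, v) ↔ u ∉ c ∧ v ∉ c := by
  simp [EOpen, siteMark]

theorem measurable_mapMarks {Y : Type*} [MeasurableSpace X] [MeasurableSpace Y] {φ : X → Y}
    (hφ : Measurable φ) : Measurable (mapMarks φ : RootedMarkedGraph X k → _) :=
  measurable_iff.2 ⟨measurable_mem_verts, measurable_adj, measurable_root,
    fun v => hφ.comp (measurable_vmark v), fun e => hφ.comp (measurable_emark e)⟩

theorem measurable_siteMark [MeasurableSpace X] {Ω : Type*} [MeasurableSpace Ω]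
    {g : Ω → RootedMarkedGraph X k} {c : Ω → Set ℕ} (hg : Measurable g)
    (hc : ∀ v, Measurable fun a => v ∈ c a) : Measurable fun a => (g a).siteMark (c a) := by
  classical
  obtain ⟨h1, h2, h3, h4, h5⟩ := measurable_iff.1 hg
  have hdec : ∀ {P : Ω → Prop}, Measurable P → Measurable fun a => decide (P a) := by
    intro P hP
    refine measurable_to_bool ?_
    convert hP.setOf using 1
    ext a
    simp
  refine measurable_iff.2 ⟨h1, h2, h3, fun v => (h4 v).prodMk ?_, fun e => (h5 e).prodMk ?_⟩
  · convert hdec (hc v).not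
  · convert hdec (P := fun a => ∀ v, v ∈ e → v ∉ c a) (Measurable.forall fun v =>
      measurable_const.imp (hc v).not)

end RootedMarkedGraph

namespace GraphClass

theorem measurable_mapMarks {X Y : Type*} {k : ℕ} [MeasurableSpace X] [MeasurableSpace Y]
    {φ : X → Y} (hφ : Measurable φ) : Measurable (mapMarks φ : GraphClass X k → _) :=
  measurable_of_comp_mk (measurable_mk.comp (RootedMarkedGraph.measurable_mapMarks hφ))

end GraphClass

/-- A measurable isomorphism-invariant rule which chooses the closed vertices of a site percolation
as a function of a marked graph and of labels of its vertices. -/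
structure SiteFactor (X : Type*) [MeasurableSpace X] where
  closed : MarkedGraph X → (ℕ → I) → Set ℕ
  mem_closed_iff : ∀ (a b : MarkedGraph X) (e : a.graph.coe ≃g b.graph.coe),
    (∀ v : a.graph.verts, b.vmark (e v) = a.vmark v) →
    (∀ u v : a.graph.verts, a.graph.Adj u v → b.emark s(↑(e u), ↑(e v)) = a.emark s(↑u, ↑v)) →
    ∀ U U' : ℕ → I, (∀ v : a.graph.verts, U' (e v) = U v) →
    ∀ v : a.graph.verts, ↑(e v) ∈ closed b U' ↔ ↑v ∈ closed a U
  measurable_closed : ∀ (k v : ℕ), Measurable fun z : RootedMarkedGraph X k × (ℕ → I) =>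
    v ∈ closed z.1.toMarkedGraph z.2

namespace SiteFactor

variable {X : Type*} [MeasurableSpace X] (F : SiteFactor X) {k : ℕ}

/-- The class of a labelled marked graph, marked by the site percolation. -/
noncomputable def apply (g : RootedMarkedGraph X k) (U : ℕ → I) : GraphClass (X × Bool) k :=
  GraphClass.mk (g.siteMark (F.closed g.toMarkedGraph U))

theorem labelInvariant_apply :
    RootedMarkedGraph.LabelInvariant (F.apply : RootedMarkedGraph X k → _) := by
  intro a b e h1 h2 h3 U U' hU
  have hc := F.mem_closed_iff a.toMarkedGraph b.toMarkedGraph e h2 h3 U U' hU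
  refine Quotient.sound ⟨e, h1, fun v => Prod.ext (h2 v) ?_, fun u v huv =>
    Prod.ext (h3 u v huv) ?_⟩
  · simp only [RootedMarkedGraph.siteMark]
    exact decide_eq_decide.2 (not_congr (hc v))
  · simp only [RootedMarkedGraph.siteMark]
    refine decide_eq_decide.2 ?_
    simp only [Sym2.mem_iff, forall_eq_or_imp, forall_eq]
    exact and_congr (not_congr (hc u)) (not_congr (hc v))

theorem measurable_uncurry_siteMark : Measurable (Function.uncurry fun
    (g : RootedMarkedGraph X k) U => g.siteMark (F.closed g.toMarkedGraph U)) :=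
  RootedMarkedGraph.measurable_siteMark measurable_fst (F.measurable_closed k)

theorem measurable_siteMark (g : RootedMarkedGraph X k) :
    Measurable fun U => g.siteMark (F.closed g.toMarkedGraph U) :=
  F.measurable_uncurry_siteMark.comp measurable_prodMk_left

theorem measurable_uncurry_apply :
    Measurable (Function.uncurry (F.apply : RootedMarkedGraph X k → _)) :=
  GraphClass.measurable_mk.comp F.measurable_uncurry_siteMark

theorem measurable_apply (g : RootedMarkedGraph X k) : Measurable (F.apply g) :=
  F.measurable_uncurry_apply.comp measurable_prodMk_left

/-- The conditional law of the marked graph with the site percolation. -/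
noncomputable def kernel : GraphClass X 1 → Measure (GraphClass (X × Bool) 1) :=
  GraphClass.randomize F.apply F.labelInvariant_apply F.measurable_uncurry_apply

theorem measurable_kernel : Measurable F.kernel :=
  GraphClass.measurable_randomize _ _

/-- The joint law of a random rooted marked graph with law `ξ` and of the site percolation. -/
noncomputable def law (ξ : Measure (GraphClass X 1)) : Measure (GraphClass (X × Bool) 1) :=
  ξ.bind F.kernel

/-- The average of `f` over the labels. -/
noncomputable def averaged (f : GraphClass (X × Bool) k → ℝ≥0∞) (hf : Measurable f) :
    GraphClass X k → ℝ≥0∞ :=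
  GraphClass.average (fun g U => f (F.apply g U)) (F.labelInvariant_apply.comp f)
    (hf.comp F.measurable_uncurry_apply)

/-- The set `closed` does not depend on the roots, so the same labels serve for all pairs of roots,
and the sum over vertices can be exchanged with the average over labels. -/
theorem lintegral_massOut_kernel {f : GraphClass (X × Bool) 2 → ℝ≥0∞} (hf : Measurable f)
    (q : GraphClass X 1) :
    ∫⁻ q', GraphClass.massOut f q' ∂F.kernel q = GraphClass.massOut (F.averaged f hf) q := by
  induction q using Quotient.inductionOn with
  | _ g =>
    change ∫⁻ q', _ ∂(labelMeasure ℕ).map (F.apply g) = _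
    rw [lintegral_map (GraphClass.measurable_massOut hf) (F.measurable_apply g)]
    exact lintegral_tsum fun o =>
      (hf.comp (F.measurable_apply (g.withRoots (g.root 0) o))).aemeasurable

theorem lintegral_massIn_kernel {f : GraphClass (X × Bool) 2 → ℝ≥0∞} (hf : Measurable f)
    (q : GraphClass X 1) :
    ∫⁻ q', GraphClass.massIn f q' ∂F.kernel q = GraphClass.massIn (F.averaged f hf) q := by
  induction q using Quotient.inductionOn with
  | _ g =>
    change ∫⁻ q', _ ∂(labelMeasure ℕ).map (F.apply g) = _
    rw [lintegral_map (GraphClass.measurable_massIn hf) (F.measurable_apply g)]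
    exact lintegral_tsum fun o =>
      (hf.comp (F.measurable_apply (g.withRoots o (g.root 0)))).aemeasurable

variable {ξ : Measure (GraphClass X 1)}

theorem map_fst_law : (F.law ξ).map (GraphClass.mapMarks Prod.fst) = ξ := by
  ext s hs
  have hm : Measurable (GraphClass.mapMarks Prod.fst : GraphClass (X × Bool) 1 → _) :=
    GraphClass.measurable_mapMarks measurable_fst
  rw [Measure.map_apply hm hs, law, Measure.bind_apply (hm hs) F.measurable_kernel.aemeasurable,
    ← lintegral_indicator_one hs]
  refine lintegral_congr fun q => ?_
  induction q using Quotient.inductionOn with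
  | _ g =>
    change (labelMeasure ℕ).map (F.apply g) _ = _
    rw [Measure.map_apply (F.measurable_apply g) (hm hs)]
    -- Forgetting the new marks recovers `g` whatever the labels are, so this event is either
    -- everything or empty.
    have h : F.apply g ⁻¹' (GraphClass.mapMarks Prod.fst ⁻¹' s) =
        {_U | (GraphClass.mk g : GraphClass X 1) ∈ s} := rfl
    rw [h]
    by_cases hg : (GraphClass.mk g : GraphClass X 1) ∈ s
    · simp only [hg, Set.ofPred_true, measure_univ]
      exact (Set.indicator_of_mem hg (1 : GraphClass X 1 → ℝ≥0∞)).symm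
    · simp only [hg, Set.ofPred_false, measure_empty]
      exact (Set.indicator_of_notMem hg (1 : GraphClass X 1 → ℝ≥0∞)).symm

/-- Mass transport of `f` for the new law is mass transport of its label average `averaged f` for
`ξ`. -/
theorem isUnimodular_law (hξ : IsUnimodular ξ) : IsUnimodular (F.law ξ) where
  isProbabilityMeasure := by
    have := hξ.isProbabilityMeasure
    have h := this.measure_univ
    rw [← F.map_fst_law (ξ := ξ), Measure.map_apply
      (GraphClass.measurable_mapMarks measurable_fst) MeasurableSet.univ, Set.preimage_univ] at h
    exact ⟨h⟩
  massTransport f hf := by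
    rw [law, Measure.lintegral_bind F.measurable_kernel.aemeasurable
      (GraphClass.measurable_massOut hf).aemeasurable,
      Measure.lintegral_bind F.measurable_kernel.aemeasurable
      (GraphClass.measurable_massIn hf).aemeasurable]
    simp only [lintegral_massOut_kernel F hf, lintegral_massIn_kernel F hf]
    exact hξ.massTransport _ (GraphClass.measurable_average _ _)

/-- By disintegration over `ξ`, an invariant measurable property need only be checked on each
concrete graph for almost every labelling. -/
theorem ae_holds_law {P : RootedMarkedGraph (X × Bool) 1 → Prop}
    (hP : ∀ a b, RootedMarkedGraph.Isomorphic a b → P a → P b) (hm : Measurable P)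
    (h : ∀ᵐ q ∂ξ, q.Holds fun g => ∀ᵐ U ∂labelMeasure ℕ,
      P (g.siteMark (F.closed g.toMarkedGraph U))) :
    ∀ᵐ q ∂F.law ξ, q.Holds P := by
  have hs : MeasurableSet {q : GraphClass (X × Bool) 1 | ¬ q.Holds P} := by
    have h' : GraphClass.mk ⁻¹' {q : GraphClass (X × Bool) 1 | ¬ q.Holds P} = {g | ¬ P g} := by
      ext g
      exact not_congr (GraphClass.holds_mk_iff hP g)
    change MeasurableSet (GraphClass.mk ⁻¹' {q : GraphClass (X × Bool) 1 | ¬ q.Holds P})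
    rw [h']
    exact hm.not.setOf
  rw [ae_iff, law, Measure.bind_apply hs F.measurable_kernel.aemeasurable,
    lintegral_eq_zero_iff (f := fun q => F.kernel q {q | ¬ q.Holds P})
    ((Measure.measurable_coe hs).comp F.measurable_kernel)]
  filter_upwards [h] with q hq
  induction q using Quotient.inductionOn with
  | _ g =>
    change (labelMeasure ℕ).map (F.apply g) _ = 0
    rw [Measure.map_apply (F.measurable_apply g) hs]
    have h' := ae_iff.1 (hq g rfl)
    refine measure_mono_null (fun U hU => ?_) h'
    exact fun hPU => hU ((GraphClass.holds_mk_iff hP _).2 hPU)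

theorem isSitePercolation_law (hξ : IsUnimodular ξ) : IsSitePercolation ξ (F.law ξ) where
  isPercolation :=
    { isMarking := ⟨F.isUnimodular_law hξ, F.map_fst_law⟩
      open_of_edge := by
        refine F.ae_holds_law ?_ ?_ (Filter.Eventually.of_forall fun q g _ =>
          Filter.Eventually.of_forall fun U u v _ h => ?_)
        · rintro a b ⟨e, h1, h2, h3⟩ ha u v huv hopen
          obtain ⟨u', hu'⟩ := e.surjective ⟨u, huv.fst_mem⟩
          obtain ⟨v', hv'⟩ := e.surjective ⟨v, huv.snd_mem⟩
          obtain rfl : (e u' : ℕ) = u := congrArg Subtype.val hu'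
          obtain rfl : (e v' : ℕ) = v := congrArg Subtype.val hv'
          have hadj : a.graph.Adj u' v' := e.map_adj_iff.1 huv
          simp only [RootedMarkedGraph.VOpen, RootedMarkedGraph.EOpen, h2, h3 _ _ hadj] at ha hopen ⊢
          exact ha _ _ hadj hopen
        · refine Measurable.forall fun u => Measurable.forall fun v =>
            (RootedMarkedGraph.measurable_adj u v).imp (Measurable.imp ?_ (Measurable.and ?_ ?_))
          · exact (measurable_snd.comp (RootedMarkedGraph.measurable_emark _)).eq measurable_const
          · exact (measurable_snd.comp (RootedMarkedGraph.measurable_vmark _)).eq measurable_const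
          · exact (measurable_snd.comp (RootedMarkedGraph.measurable_vmark _)).eq measurable_const
        · rwa [RootedMarkedGraph.siteMark_vOpen_iff, RootedMarkedGraph.siteMark_vOpen_iff,
            ← RootedMarkedGraph.siteMark_eOpen_iff] }
  edge_of_open := by
    refine F.ae_holds_law ?_ ?_ (Filter.Eventually.of_forall fun q g _ =>
      Filter.Eventually.of_forall fun U u v _ h h' => ?_)
    · rintro a b ⟨e, h1, h2, h3⟩ ha u v huv hu hv
      obtain ⟨u', hu'⟩ := e.surjective ⟨u, huv.fst_mem⟩
      obtain ⟨v', hv'⟩ := e.surjective ⟨v, huv.snd_mem⟩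
      obtain rfl : (e u' : ℕ) = u := congrArg Subtype.val hu'
      obtain rfl : (e v' : ℕ) = v := congrArg Subtype.val hv'
      have hadj : a.graph.Adj u' v' := e.map_adj_iff.1 huv
      simp only [RootedMarkedGraph.VOpen, RootedMarkedGraph.EOpen, h2, h3 _ _ hadj] at ha hu hv ⊢
      exact ha _ _ hadj hu hv
    · refine Measurable.forall fun u => Measurable.forall fun v =>
        (RootedMarkedGraph.measurable_adj u v).imp (Measurable.imp ?_ (Measurable.imp ?_ ?_))
      · exact (measurable_snd.comp (RootedMarkedGraph.measurable_vmark _)).eq measurable_const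
      · exact (measurable_snd.comp (RootedMarkedGraph.measurable_vmark _)).eq measurable_const
      · exact (measurable_snd.comp (RootedMarkedGraph.measurable_emark _)).eq measurable_const
    · rw [RootedMarkedGraph.siteMark_vOpen_iff] at h h'
      exact RootedMarkedGraph.siteMark_eOpen_iff.2 ⟨h, h'⟩

/-- The rate is the `ξ`-average of the conditional probability that the root is closed, and `B`
bounds the latter. -/
theorem percolationRate_law_le {B : GraphClass X 1 → ℝ≥0∞}
    (h : ∀ᵐ q ∂ξ, q.Holds fun g =>
      labelMeasure ℕ {U | (g.root 0 : ℕ) ∈ F.closed g.toMarkedGraph U} ≤ B (GraphClass.mk g)) :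
    percolationRate (F.law ξ) ≤ ∫⁻ q, B q ∂ξ := by
  set P : RootedMarkedGraph (X × Bool) 1 → Prop := fun g => ¬ g.VOpen (g.root 0) with hPdef
  have hP : ∀ a b, RootedMarkedGraph.Isomorphic a b → P a → P b := by
    rintro a b ⟨e, h1, h2, h3⟩ ha
    simp only [hPdef, RootedMarkedGraph.VOpen] at ha ⊢
    rwa [← h1, h2]
  have hs : MeasurableSet {q : GraphClass (X × Bool) 1 | q.Holds P} := by
    have h' : GraphClass.mk ⁻¹' {q : GraphClass (X × Bool) 1 | q.Holds P} = {g | P g} := by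
      ext g
      exact GraphClass.holds_mk_iff hP g
    change MeasurableSet (GraphClass.mk ⁻¹' {q : GraphClass (X × Bool) 1 | q.Holds P})
    rw [h']
    have h'' : ∀ g : RootedMarkedGraph (X × Bool) 1,
        P g ↔ ∃ v : ℕ, (g.root 0 : ℕ) = v ∧ ¬ (g.vmark v).2 = true := fun g => by
      simp [hPdef, RootedMarkedGraph.VOpen]
    simp only [h'']
    exact (Measurable.exists fun v => ((RootedMarkedGraph.measurable_root 0).eq
      measurable_const).and ((measurable_snd.comp
      (RootedMarkedGraph.measurable_vmark v)).eq measurable_const).not).setOf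
  rw [percolationRate, law, Measure.bind_apply hs F.measurable_kernel.aemeasurable]
  refine lintegral_mono_ae ?_
  filter_upwards [h] with q hq
  induction q using Quotient.inductionOn with
  | _ g =>
    change (labelMeasure ℕ).map (F.apply g) _ ≤ _
    rw [Measure.map_apply (F.measurable_apply g) hs]
    refine (measure_mono fun U hU => ?_).trans (hq g rfl)
    have := (GraphClass.holds_mk_iff hP _).1 hU
    simp only [hPdef, RootedMarkedGraph.siteMark_vOpen_iff, not_not] at this
    exact this

end SiteFactor

/-! ### Components as cluster embeddings. -/

namespace SimpleGraph

variable {V V' V'' : Type*}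

theorem IsClusterEmbedding.comp {H : SimpleGraph V} {H' : SimpleGraph V'} {H'' : SimpleGraph V''}
    {f : V → V'} {f' : V' → V''} (hf' : IsClusterEmbedding H' H'' f')
    (hf : IsClusterEmbedding H H' f) : IsClusterEmbedding H H'' (f' ∘ f) where
  injective := hf'.injective.comp hf.injective
  adj_iff u w' := by
    simp only [Function.comp_apply, hf'.adj_iff, hf.adj_iff]
    constructor
    · rintro ⟨_, rfl, w, rfl, h⟩
      exact ⟨w, rfl, h⟩
    · rintro ⟨w, rfl, h⟩
      exact ⟨_, rfl, w, rfl, h⟩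

theorem ConnectedComponent.isClusterEmbedding_val {H : SimpleGraph V} (C : H.ConnectedComponent) :
    IsClusterEmbedding C.toSimpleGraph H Subtype.val where
  injective := Subtype.val_injective
  adj_iff u w := by
    constructor
    · intro h
      have hw : w ∈ C.supp := by
        have hu : H.connectedComponentMk u = C := u.2
        exact (ConnectedComponent.eq.2 h.reachable.symm).trans hu
      exact ⟨⟨w, hw⟩, rfl, h⟩
    · rintro ⟨w, rfl, h⟩
      exact h

theorem Unbounded.exists_adj {H : SimpleGraph V} {v : V} (hv : H.Unbounded v) :
    ∃ w, H.Adj v w := by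
  obtain ⟨w, hw, hw'⟩ := hv 0
  rcases edist_le_succ_iff.1 hw with h | ⟨x, hx, -⟩
  · exact absurd h hw'
  · exact ⟨x, hx⟩

theorem connected_induce_setOf_reachable {G H : SimpleGraph V} (hHG : H ≤ G) (v : V) :
    (G.induce {w | H.Reachable v w}).Connected := by
  have hv : v ∈ {w | H.Reachable v w} := Reachable.refl _
  rw [connected_iff_exists_forall_reachable]
  refine ⟨⟨v, hv⟩, ?_⟩
  rintro ⟨w, ⟨q⟩⟩
  induction q using Walk.concatRec with
  | Hnil => exact Reachable.refl _
  | Hconcat q hadj ih =>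
    refine (ih hv).trans (Adj.reachable ?_)
    exact hHG hadj

end SimpleGraph

/-! ### The graph of open edges -/

namespace MarkedGraph

variable {X : Type*}

/-- The open subgraph, as a graph on `ℕ`. -/
def openGraph (m : MarkedGraph (X × Bool)) : SimpleGraph ℕ where
  Adj u v := m.graph.Adj u v ∧ (m.emark s(u, v)).2 = true ∧ (m.vmark u).2 = true ∧
    (m.vmark v).2 = true
  symm := ⟨fun _ _ h => ⟨h.1.symm, Sym2.eq_swap ▸ h.2.1, h.2.2.2, h.2.2.1⟩⟩
  loopless := ⟨fun _ h => h.1.ne rfl⟩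

theorem finite_neighborSet_openGraph (m : MarkedGraph (X × Bool)) (v : ℕ) :
    (m.openGraph.neighborSet v).Finite :=
  (m.locallyFinite v).subset fun _ h => h.1

theorem isClusterEmbedding_val (m : MarkedGraph (X × Bool)) :
    SimpleGraph.IsClusterEmbedding (m.openGraph.comap (Subtype.val : m.graph.verts → ℕ))
      m.openGraph Subtype.val where
  injective := Subtype.val_injective
  adj_iff _ w := ⟨fun h => ⟨⟨w, h.1.snd_mem⟩, rfl, h⟩, fun ⟨_, hw, h⟩ => hw ▸ h⟩

/-- An isomorphism of marked graphs says nothing about numbers that are not vertices, so it does not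
act on `openGraph`, which lives on all of `ℕ`. Two cluster embeddings of the open graph on the
vertices of `a`, this one and `isClusterEmbedding_val`, take its place. -/
theorem isClusterEmbedding_iso {a b : MarkedGraph (X × Bool)} (e : a.graph.coe ≃g b.graph.coe)
    (hv : ∀ v : a.graph.verts, b.vmark (e v) = a.vmark v)
    (he : ∀ u v : a.graph.verts, a.graph.Adj u v →
      b.emark s(↑(e u), ↑(e v)) = a.emark s(↑u, ↑v)) :
    SimpleGraph.IsClusterEmbedding (a.openGraph.comap (Subtype.val : a.graph.verts → ℕ))
      b.openGraph fun v => (e v : ℕ) where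
  injective := Subtype.val_injective.comp e.injective
  adj_iff u w' := by
    have key : ∀ w, b.openGraph.Adj (e u) (e w) ↔ a.openGraph.Adj u w := by
      intro w
      have hadj : b.graph.Adj (e u) (e w) ↔ a.graph.Adj u w := e.map_adj_iff
      simp only [openGraph, hv, hadj]
      exact and_congr_right fun h => by rw [he u w h]
    constructor
    · intro h
      obtain ⟨w, hw⟩ := e.surjective ⟨w', h.1.snd_mem⟩
      obtain rfl : (e w : ℕ) = w' := congrArg Subtype.val hw
      exact ⟨w, rfl, (key w).1 h⟩
    · rintro ⟨w, rfl, h⟩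
      exact (key w).2 h

end MarkedGraph

namespace RootedMarkedGraph

variable {X : Type*} {k : ℕ}

theorem isClusterEmbedding_openSubgraph (g : RootedMarkedGraph (X × Bool) k) :
    SimpleGraph.IsClusterEmbedding g.openSubgraph.coe g.toMarkedGraph.openGraph
      (Subtype.val : g.openSubgraph.verts → ℕ) where
  injective := Subtype.val_injective
  adj_iff _ w := ⟨fun h => ⟨⟨w, h.1.snd_mem, h.2.2.2⟩, rfl, h⟩, fun ⟨_, hw, h⟩ => hw ▸ h⟩

theorem measurable_adj_openGraph [MeasurableSpace X] (u v : ℕ) :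
    Measurable fun g : RootedMarkedGraph (X × Bool) k => g.toMarkedGraph.openGraph.Adj u v :=
  (measurable_adj u v).and (((measurable_snd.comp (measurable_emark _)).eq measurable_const).and
    (((measurable_snd.comp (measurable_vmark _)).eq measurable_const).and
    ((measurable_snd.comp (measurable_vmark _)).eq measurable_const)))

theorem encard_neighborSet_openGraph_le {D : ℕ} {g : RootedMarkedGraph (X × Bool) k}
    (hg : g.OpenDegreeLE D) (v : ℕ) : (g.toMarkedGraph.openGraph.neighborSet v).encard ≤ D := by
  by_cases hv : v ∈ g.openSubgraph.verts
  · exact hg v hv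
  · rw [Set.eq_empty_of_forall_notMem (s := g.toMarkedGraph.openGraph.neighborSet v)
      fun w hw => hv ⟨hw.1.fst_mem, hw.2.2.1⟩]
    simp

/-- A vertex of an unbounded cluster has an open edge, so it lies in an infinite component of the
open subgraph. Growth holds in that component, and its embedding into `ℕ` maps balls onto balls. The
constant `β` caps `α` at `1`, as the growth lemma requires. -/
theorem one_le_mul_ncard_openGraph {α : ℝ} {g : RootedMarkedGraph (X × Bool) k}
    (hg : g.InfiniteClustersExpand α) {β : ℝ} (hβ : β ≤ 1) (hβα : β ≤ α) {v : ℕ}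
    (hv : g.toMarkedGraph.openGraph.Unbounded v) (n : ℕ) :
    1 ≤ (1 - β) ^ n * ({w | g.toMarkedGraph.openGraph.edist v w ≤ n}.ncard : ℝ) := by
  obtain ⟨w, hw⟩ := hv.exists_adj
  set v' : g.openSubgraph.verts := ⟨v, hw.1.fst_mem, hw.2.2.1⟩ with hv'
  set C := g.openSubgraph.coe.connectedComponentMk v' with hC
  have hemb := g.isClusterEmbedding_openSubgraph
  have hcomp := hemb.comp C.isClusterEmbedding_val
  have hfin : ∀ u, (C.toSimpleGraph.neighborSet u).Finite := fun u =>
    ((g.finite_neighborSet_openGraph u.1).preimage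
      (hcomp.injective.injOn)).subset fun x hx => hcomp.adj_map_iff.2 hx
  have hinf : C.supp.Infinite := by
    have hunb : g.openSubgraph.coe.Unbounded v' := hemb.unbounded_iff.1 hv
    refine hunb.infinite.mono fun x hx => ?_
    exact SimpleGraph.ConnectedComponent.eq.2 hx.symm
  have h := one_le_mul_ncard_of_le_vertexExpansionConstant hβ hfin (hβα.trans (hg C hinf))
    ⟨v', rfl⟩ n
  rwa [← Set.ncard_image_of_injective _ hcomp.injective, hcomp.image_setOf_edist_le] at h

/-! ### First-order versions of the two properties of the closed vertices -/

/-- Every vertex in an unbounded cluster of the first percolation is at distance at most `h` from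
a vertex which is closed for the second one. -/
def ClosedNearUnbounded (h : ℕ) (g : RootedMarkedGraph ((X × Bool) × Bool) k) : Prop :=
  ∀ v ∈ g.graph.verts, (g.mapMarks Prod.fst).openGraph.Unbounded v →
    ∃ w, (g.mapMarks Prod.fst).openGraph.edist v w ≤ h ∧ ¬ g.VOpen w

/-- Every vertex which is closed for the second percolation is connected, by edges between closed
vertices which are open for the first percolation, to two vertices at distance `N`. -/
def ClosedInLongClusters (N : ℕ) (g : RootedMarkedGraph ((X × Bool) × Bool) k) : Prop :=
  ∀ v ∈ g.graph.verts, ¬ g.VOpen v → ∃ m : ℕ, ∃ t,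
    ((g.mapMarks Prod.fst).openGraph.within {v | ¬ g.VOpen v}).edist v t ≤ m ∧
    ∃ w, ((g.mapMarks Prod.fst).openGraph.within {v | ¬ g.VOpen v}).edist t w ≤ N ∧
      ∀ i : ℕ, i < N →
        ¬ ((g.mapMarks Prod.fst).openGraph.within {v | ¬ g.VOpen v}).edist t w ≤ i

theorem ClosedNearUnbounded.of_isomorphic {h : ℕ} {a b : RootedMarkedGraph ((X × Bool) × Bool) k}
    (hab : Isomorphic a b) (ha : a.ClosedNearUnbounded h) : b.ClosedNearUnbounded h := by
  obtain ⟨e, -, h2, h3⟩ := hab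
  have hopen : ∀ v : a.graph.verts, b.VOpen (e v) ↔ a.VOpen v := fun v => by
    simp only [VOpen, h2]
  have he := MarkedGraph.isClusterEmbedding_iso (a := (a.mapMarks Prod.fst).toMarkedGraph)
    (b := (b.mapMarks Prod.fst).toMarkedGraph) e (fun v => congrArg Prod.fst (h2 v))
    fun u v huv => congrArg Prod.fst (h3 u v huv)
  have hi := (a.mapMarks Prod.fst).isClusterEmbedding_val
  intro v hv hunb
  obtain ⟨v', hv'⟩ := e.surjective ⟨v, hv⟩
  obtain rfl : (e v' : ℕ) = v := congrArg Subtype.val hv'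
  have hmain := ha v' v'.2 (hi.unbounded_iff.2 (he.unbounded_iff.1 hunb))
  exact he.exists_edist_le.2 ((hi.exists_edist_le.1 hmain).imp fun w hw =>
    ⟨hw.1, fun hb => hw.2 ((hopen w).1 hb)⟩)

theorem ClosedInLongClusters.of_isomorphic {N : ℕ} {a b : RootedMarkedGraph ((X × Bool) × Bool) k}
    (hab : Isomorphic a b) (ha : a.ClosedInLongClusters N) : b.ClosedInLongClusters N := by
  obtain ⟨e, -, h2, h3⟩ := hab
  have hopen : ∀ v : a.graph.verts, b.VOpen (e v) ↔ a.VOpen v := fun v => by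
    simp only [VOpen, h2]
  have he := (MarkedGraph.isClusterEmbedding_iso (a := (a.mapMarks Prod.fst).toMarkedGraph)
    (b := (b.mapMarks Prod.fst).toMarkedGraph) e (fun v => congrArg Prod.fst (h2 v))
    fun u v huv => congrArg Prod.fst (h3 u v huv)).within {v | ¬ b.VOpen v}
  have hi := (a.mapMarks Prod.fst).isClusterEmbedding_val.within {v | ¬ a.VOpen v}
  have hpre : (fun v => ((e v : b.graph.verts) : ℕ)) ⁻¹' {v | ¬ b.VOpen v} =
      (Subtype.val : a.graph.verts → ℕ) ⁻¹' {v | ¬ a.VOpen v} := by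
    ext v
    exact not_congr (hopen v)
  have he' := hpre ▸ he
  intro v hv hclosed
  obtain ⟨v', hv'⟩ := e.surjective ⟨v, hv⟩
  obtain rfl : (e v' : ℕ) = v := congrArg Subtype.val hv'
  obtain ⟨m, hmain⟩ := ha v' v'.2 (by rwa [hopen] at hclosed)
  obtain ⟨t, ht, hmain⟩ := hi.exists_edist_le.1 hmain
  obtain ⟨w, hw, hmain⟩ := hi.exists_edist_le.1 hmain
  exact ⟨m, he'.exists_edist_le.2 ⟨t, ht, he'.exists_edist_le.2 ⟨w, hw, fun i hiN hle =>
    hmain i hiN (hi.edist_map_le_iff.2 (he'.edist_map_le_iff.1 hle))⟩⟩⟩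

/-! ### Measurability of the two first-order properties. -/

section Measurability

variable [MeasurableSpace X]

theorem measurable_vOpen (v : ℕ) :
    Measurable fun g : RootedMarkedGraph (X × Bool) k => g.VOpen v :=
  (measurable_snd.comp (measurable_vmark v)).eq measurable_const

theorem measurable_adj_openGraph_mapMarks_fst (u v : ℕ) :
    Measurable fun g : RootedMarkedGraph ((X × Bool) × Bool) k =>
      (g.mapMarks Prod.fst).openGraph.Adj u v :=
  (measurable_adj_openGraph u v).comp (measurable_mapMarks measurable_fst)

theorem measurable_closedNearUnbounded (h : ℕ) :
    Measurable (ClosedNearUnbounded h : RootedMarkedGraph ((X × Bool) × Bool) k → Prop) :=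
  Measurable.forall fun v => (measurable_mem_verts v).imp
    ((SimpleGraph.measurable_unbounded measurable_adj_openGraph_mapMarks_fst v).imp
    (Measurable.exists fun w => (SimpleGraph.measurable_edist_le
      measurable_adj_openGraph_mapMarks_fst h v w).and (measurable_vOpen w).not))

theorem measurable_closedInLongClusters (N : ℕ) :
    Measurable (ClosedInLongClusters N : RootedMarkedGraph ((X × Bool) × Bool) k → Prop) := by
  have hH : ∀ u v, Measurable fun g : RootedMarkedGraph ((X × Bool) × Bool) k =>
      ((g.mapMarks Prod.fst).openGraph.within {v | ¬ g.VOpen v}).Adj u v := fun u v =>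
    (measurable_adj_openGraph_mapMarks_fst u v).and
      ((measurable_vOpen u).not.and (measurable_vOpen v).not)
  exact Measurable.forall fun v => (measurable_mem_verts v).imp ((measurable_vOpen v).not.imp
    (Measurable.exists fun m => Measurable.exists fun t =>
    (SimpleGraph.measurable_edist_le hH m v t).and (Measurable.exists fun w =>
    (SimpleGraph.measurable_edist_le hH N t w).and (Measurable.forall fun i =>
      measurable_const.imp (SimpleGraph.measurable_edist_le hH i t w).not))))

end Measurability

theorem ClosedNearUnbounded.closedWithin {h : ℕ} {g : RootedMarkedGraph ((X × Bool) × Bool) k}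
    (hg : g.ClosedNearUnbounded h) : g.ClosedWithin h := by
  intro v _ hinf
  have hemb : SimpleGraph.IsClusterEmbedding g.firstOpenSubgraph.coe
      (g.mapMarks Prod.fst).openGraph Subtype.val :=
    (g.mapMarks Prod.fst).isClusterEmbedding_openSubgraph
  have hfin : ∀ u, (g.firstOpenSubgraph.coe.neighborSet u).Finite := fun u =>
    (((g.mapMarks Prod.fst).finite_neighborSet_openGraph u).preimage
      hemb.injective.injOn).subset fun x hx => hemb.adj_map_iff.2 hx
  have hunb : g.firstOpenSubgraph.coe.Unbounded v := by
    refine SimpleGraph.unbounded_of_infinite hfin (hinf.mono fun w hw => ?_)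
    exact (SimpleGraph.ConnectedComponent.eq.1 hw).symm
  obtain ⟨w, hw, hclosed⟩ := hemb.exists_edist_le.1 (hg v v.2.1 (hemb.unbounded_iff.2 hunb))
  exact ⟨w, hclosed, hw⟩

/-- Take for `Ψ` the cluster of `v` in the open graph restricted to closed vertices; it contains a
geodesic with `N` edges. -/
theorem ClosedInLongClusters.closedInLargeConnected {N : ℕ}
    {g : RootedMarkedGraph ((X × Bool) × Bool) k} (hg : g.ClosedInLongClusters N) :
    g.ClosedInLargeConnected N := by
  intro v hv
  have hemb : SimpleGraph.IsClusterEmbedding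
      (g.firstOpenSubgraph.coe.within (Subtype.val ⁻¹' {v | ¬ g.VOpen v}))
      ((g.mapMarks Prod.fst).openGraph.within {v | ¬ g.VOpen v}) Subtype.val :=
    (g.mapMarks Prod.fst).isClusterEmbedding_openSubgraph.within _
  set K := g.firstOpenSubgraph.coe.within (Subtype.val ⁻¹' {v | ¬ g.VOpen v}) with hK
  obtain ⟨m, hmain⟩ := hg v v.2.1 hv
  obtain ⟨t, ht, hmain⟩ := hemb.exists_edist_le.1 hmain
  obtain ⟨w, hw, hmin⟩ := hemb.exists_edist_le.1 hmain
  have hvt : K.Reachable v t := SimpleGraph.reachable_iff_exists_edist_le.2 ⟨m, ht⟩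
  refine ⟨{w | K.Reachable v w}, SimpleGraph.Reachable.refl _, ?_, ?_,
    SimpleGraph.connected_induce_setOf_reachable (SimpleGraph.within_le _ _) v⟩
  · have htw : K.edist t w = N := by
      refine le_antisymm hw (not_lt.1 fun hlt => ?_)
      obtain ⟨i, hi⟩ := ENat.ne_top_iff_exists.1 (ne_top_of_lt hlt)
      rw [← hi] at hlt
      exact hmin i (by exact_mod_cast hlt) (hemb.edist_map_le_iff.2 hi.ge)
    have hset : {w | K.Reachable v w} = {w | K.Reachable t w} :=
      Set.ext fun x => ⟨hvt.symm.trans, hvt.trans⟩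
    rw [hset]
    refine le_trans ?_ (SimpleGraph.le_encard_reachable htw)
    exact_mod_cast Nat.le_succ N
  -- Every vertex of the cluster is `v` or the end of an edge of `K`, whose endpoints are closed.
  · rintro x ⟨q⟩
    induction q using SimpleGraph.Walk.concatRec with
    | Hnil => exact hv
    | Hconcat q hadj ih => exact hadj.2.2

end RootedMarkedGraph

/-! ### Estimates for independent uniform labels -/

theorem labelMeasure_setOf_lt {ι : Type*} (i : ι) (δ : I) :
    labelMeasure ι {U | U i < δ} = ENNReal.ofReal δ := by
  have h := Measure.infinitePi_map_eval (fun _ : ι => (volume : Measure I)) i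
  rw [← unitInterval.volume_Iio, ← h, Measure.map_apply (measurable_pi_apply i) measurableSet_Iio]
  rfl

theorem labelMeasure_forall_le {ι : Type*} (s : Finset ι) (p : I) :
    labelMeasure ι {U | ∀ i ∈ s, p ≤ U i} = ENNReal.ofReal (1 - p) ^ s.card := by
  have h := Measure.infinitePi_pi (fun _ : ι => (volume : Measure I)) (s := s)
    (t := fun _ => Set.Ici p) fun i _ => measurableSet_Ici
  rw [unitInterval.volume_Ici, Finset.prod_const] at h
  exact h

theorem labelMeasure_exists_lt_le {ι : Type*} {s : Set ι} {M : ℕ} (hs : s.encard ≤ M) (δ : I) :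
    labelMeasure ι {U | ∃ i ∈ s, U i < δ} ≤ M * ENNReal.ofReal δ := by
  have hfin : s.Finite := Set.finite_of_encard_le_coe hs
  have hcard : hfin.toFinset.card ≤ M := by
    rw [hfin.encard_eq_coe_toFinset_card] at hs
    exact_mod_cast hs
  have hset : {U : ι → I | ∃ i ∈ s, U i < δ} = ⋃ i ∈ hfin.toFinset, {U : ι → I | U i < δ} := by
    ext U
    simp
  rw [hset]
  refine (measure_biUnion_finset_le _ _).trans ?_
  simp only [labelMeasure_setOf_lt, Finset.sum_const, nsmul_eq_mul]
  gcongr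

/-- Among `n` of the vertices all labels are at least `δ` with probability `(1 - δ) ^ n`, which
tends to `0`. -/
theorem ae_exists_lt_labelMeasure {ι : Type*} {s : Set ι} (hs : s.Infinite) {δ : I} (hδ : 0 < δ) :
    ∀ᵐ U ∂labelMeasure ι, ∃ i ∈ s, U i < δ := by
  rw [ae_iff]
  have hlt : ENNReal.ofReal (1 - δ) < 1 := by
    rw [ENNReal.ofReal_lt_one]
    have : (0 : ℝ) < δ := hδ
    linarith
  refine le_antisymm (ge_of_tendsto' (ENNReal.tendsto_pow_atTop_nhds_zero_of_lt_one hlt)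
    fun n => ?_) zero_le
  obtain ⟨t, hts, htn⟩ := hs.exists_subset_card_eq n
  rw [← htn, ← labelMeasure_forall_le]
  refine measure_mono fun U hU i hi => ?_
  by_contra! hcon
  exact hU ⟨i, hts hi, hcon⟩

/-- Multiply by `(1 + p) ^ n`, which is at least `p * n` by Bernoulli, and use `(1 - p) * (1 + p) ≤
1`. -/
theorem one_sub_pow_le_inv {p : ℝ} (hp : 0 < p) (hp1 : p ≤ 1) {n : ℕ} (hn : 0 < n) :
    (1 - p) ^ n ≤ 1 / (p * n) := by
  have hb : 1 + (n : ℝ) * p ≤ (1 + p) ^ n := one_add_mul_le_pow (by linarith) n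
  have hpn : 0 < p * n := by positivity
  have h1 : (1 - p) ^ n * (1 + p) ^ n ≤ 1 := by
    rw [← mul_pow]
    exact pow_le_one₀ (by nlinarith) (by nlinarith)
  rw [le_div_iff₀ hpn]
  calc (1 - p) ^ n * (p * n) ≤ (1 - p) ^ n * (1 + p) ^ n :=
        mul_le_mul_of_nonneg_left (by linarith) (pow_nonneg (by linarith) n)
    _ ≤ 1 := h1

/-- Union bound: either the label of `v` is small, or none is in a ball with at least `K` points. -/
theorem labelMeasure_isHub_le {H : SimpleGraph ℕ} (hfin : ∀ v, (H.neighborSet v).Finite)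
    {r : ℕ} {p : I} (hp : 0 < p) {K : ℝ} (hK : 0 < K) {v : ℕ}
    (hball : H.Unbounded v → K ≤ {w | H.edist v w ≤ r}.ncard) :
    labelMeasure ℕ {U | H.IsHub r p U v} ≤ ENNReal.ofReal (p + 1 / (p * K)) := by
  by_cases hv : H.Unbounded v
  swap
  · rw [show {U : ℕ → I | H.IsHub r p U v} = ∅ from
      Set.eq_empty_of_forall_notMem fun U hU => hv hU.1]
    simp
  have hp' : (0 : ℝ) < p := hp
  have hB := SimpleGraph.finite_setOf_edist_le hfin v r
  have hKB : K ≤ hB.toFinset.card := by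
    rw [← Set.ncard_eq_toFinset_card _ hB]
    exact hball hv
  have hpos : 0 < hB.toFinset.card := by
    have := hK.trans_le hKB
    exact_mod_cast this
  have hsub : {U : ℕ → I | H.IsHub r p U v} ⊆
      {U | U v < p} ∪ {U | ∀ i ∈ hB.toFinset, p ≤ U i} := by
    rintro U ⟨-, h | h⟩
    · exact Or.inl h
    · exact Or.inr fun i hi => h i (by simpa using hi)
  refine (measure_mono hsub).trans ((measure_union_le _ _).trans ?_)
  rw [labelMeasure_setOf_lt, labelMeasure_forall_le, ENNReal.ofReal_add hp'.le (by positivity),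
    ← ENNReal.ofReal_pow (by linarith [p.2.2])]
  refine add_le_add_right (ENNReal.ofReal_le_ofReal
    ((one_sub_pow_le_inv hp' p.2.2 hpos).trans ?_)) _
  gcongr

/-- The two terms are `2 / (r + 1)` and `2 * (r + 1) ^ 3 / γ ^ r`: with `p = 1 / (r + 1) ^ 2`, hubs
of small label are rare compared with the length of a road, yet a ball of size `γ ^ r` very likely
contains one. -/
theorem exists_radius {γ : ℝ} (hγ : 1 < γ) {η : ℝ} (hη : 0 < η) :
    ∃ r : ℕ, 0 < r ∧
      (2 * r + 2 : ℝ) * (1 / (r + 1) ^ 2 + 1 / (1 / (r + 1) ^ 2 * γ ^ r)) ≤ η := by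
  have h1 : Filter.Tendsto (fun r : ℕ => 2 * (1 / ((r : ℝ) + 1))) Filter.atTop (nhds (2 * 0)) :=
    tendsto_one_div_add_atTop_nhds_zero_nat.const_mul 2
  have h2 : Filter.Tendsto (fun r : ℕ => 2 * γ * (((r + 1 : ℕ) : ℝ) ^ 3 / γ ^ (r + 1)))
      Filter.atTop (nhds (2 * γ * 0)) :=
    ((Filter.tendsto_add_atTop_iff_nat 1).2
      (tendsto_pow_const_div_const_pow_of_one_lt 3 hγ)).const_mul (2 * γ)
  have h3 := h1.add h2
  simp only [mul_zero, add_zero] at h3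
  obtain ⟨r, hr, hr0⟩ := ((h3.eventually_lt_const hη).and (Filter.eventually_gt_atTop 0)).exists
  refine ⟨r, hr0, le_trans (le_of_eq ?_) hr.le⟩
  have : γ ≠ 0 := by positivity
  push_cast
  field_simp
  ring

theorem tsum_ite_le_of_encard_le {ι : Type*} {P : ι → Prop} [DecidablePred P] {s : Set ι} {M : ℕ}
    (h : {i | P i}.encard ≤ M) : ∑' i : s, (if P i then (1 : ℝ≥0∞) else 0) ≤ M := by
  have hfin : {i | P i}.Finite := Set.finite_of_encard_le_coe h
  refine (ENNReal.tsum_comp_le_tsum_of_injective Subtype.val_injective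
    fun i => if P i then (1 : ℝ≥0∞) else 0).trans ?_
  rw [tsum_eq_sum (s := hfin.toFinset) fun i hi => if_neg (by simpa using hi),
    Finset.sum_congr rfl fun i hi => if_pos (by simpa using hi)]
  rw [hfin.encard_eq_coe_toFinset_card] at h
  simpa using h

/-! ### The percolation of roads -/

section Roads

variable {X : Type*} [MeasurableSpace X]

/-- The site percolation whose closed vertices are those of `SimpleGraph.roadSet`. -/
def roadFactor (X : Type*) [MeasurableSpace X] (N r : ℕ) (p δ : I) : SiteFactor (X × Bool) where
  closed m U := m.openGraph.roadSet N r p δ U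
  mem_closed_iff a b e hv he U U' hU v := by
    rw [(MarkedGraph.isClusterEmbedding_iso e hv he).mem_roadSet_iff (v := v),
      a.isClusterEmbedding_val.mem_roadSet_iff]
    rw [show U' ∘ (fun v => (e v : ℕ)) = U ∘ Subtype.val from funext hU]
  measurable_closed k v := SimpleGraph.measurable_mem_roadSet
    (fun u v => (RootedMarkedGraph.measurable_adj_openGraph u v).comp measurable_fst)
    (fun v => (measurable_pi_apply v).comp measurable_snd) N r p δ v

variable {k N r D : ℕ} {p δ : I}

/-- Almost surely all unbounded clusters contain a seed at once, since there are countably many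
vertices; near each vertex of such a cluster there is then a hub on its own road, or a seed. -/
theorem RootedMarkedGraph.closedNearUnbounded_siteMark (hδ : 0 < δ)
    (g : RootedMarkedGraph (X × Bool) k) : ∀ᵐ U ∂labelMeasure ℕ,
      (g.siteMark ((roadFactor X N r p δ).closed g.toMarkedGraph U)).ClosedNearUnbounded r := by
  have h : ∀ᵐ U ∂labelMeasure ℕ, ∀ v, g.toMarkedGraph.openGraph.Unbounded v →
      ∃ t ∈ {t | g.toMarkedGraph.openGraph.Reachable v t}, U t < δ := by
    refine ae_all_iff.2 fun v => ?_
    by_cases hv : g.toMarkedGraph.openGraph.Unbounded v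
    · filter_upwards [ae_exists_lt_labelMeasure hv.infinite hδ] with U hU _ using hU
    · simp [hv]
  filter_upwards [h] with U hU v _ hv
  obtain ⟨t, hvt, ht⟩ := hU v hv
  obtain ⟨m, hm⟩ := SimpleGraph.reachable_iff_exists_edist_le.1 hvt
  have hseed : g.toMarkedGraph.openGraph.IsSeed δ U t :=
    ⟨SimpleGraph.Unbounded.of_edist_le hv hm, ht⟩
  obtain ⟨w, hw, hmem⟩ := SimpleGraph.Unbounded.exists_mem_roadSet (N := N) (r := r) (p := p)
    hv hseed hvt
  exact ⟨w, hw, fun hopen => RootedMarkedGraph.siteMark_vOpen_iff.1 hopen hmem⟩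

theorem RootedMarkedGraph.closedInLongClusters_siteMark (g : RootedMarkedGraph (X × Bool) k)
    (U : ℕ → I) :
    (g.siteMark ((roadFactor X N r p δ).closed g.toMarkedGraph U)).ClosedInLongClusters N := by
  intro v _ hv
  rw [RootedMarkedGraph.siteMark_vOpen_iff, not_not] at hv
  obtain ⟨t, hvt, w, hw⟩ := SimpleGraph.exists_reachable_within_of_mem_roadSet
    g.finite_neighborSet_openGraph hv
  obtain ⟨m, hm⟩ := SimpleGraph.reachable_iff_exists_edist_le.1 hvt
  simp only [RootedMarkedGraph.siteMark_vOpen_iff, not_not]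
  exact ⟨m, t, hm, w, hw.le, fun i hi hle => absurd (hw.symm.le.trans hle)
    (not_le.2 (by exact_mod_cast hi))⟩

theorem RootedMarkedGraph.labelInvariant_onRoad {X : Type*} (r : ℕ) (p δ : I) :
    LabelInvariant fun (g : RootedMarkedGraph (X × Bool) 2) U =>
      g.toMarkedGraph.openGraph.OnRoad r p δ U (g.root 0) (g.root 1) := by
  intro a b e h1 h2 h3 U U' hU
  beta_reduce
  rw [← h1, ← h1]
  have hb := (MarkedGraph.isClusterEmbedding_iso (a := a.toMarkedGraph) (b := b.toMarkedGraph)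
    e h2 h3).onRoad_iff (r := r) (p := p) (δ := δ) (U' := U') (x := a.root 0) (v := a.root 1)
  have ha := a.isClusterEmbedding_val.onRoad_iff (r := r) (p := p) (δ := δ) (U' := U)
    (x := a.root 0) (v := a.root 1)
  rw [show U' ∘ (fun v => (e v : ℕ)) = U ∘ Subtype.val from funext hU] at hb
  exact propext (ha.trans hb.symm)

theorem RootedMarkedGraph.measurable_onRoad_root (r : ℕ) (p δ : I) :
    Measurable fun z : RootedMarkedGraph (X × Bool) 2 × (ℕ → I) =>
      z.1.toMarkedGraph.openGraph.OnRoad r p δ z.2 (z.1.root 0) (z.1.root 1) := by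
  have h : ∀ z : RootedMarkedGraph (X × Bool) 2 × (ℕ → I),
      z.1.toMarkedGraph.openGraph.OnRoad r p δ z.2 (z.1.root 0) (z.1.root 1) ↔
      ∃ x v : ℕ, (z.1.root 0 : ℕ) = x ∧ (z.1.root 1 : ℕ) = v ∧
        z.1.toMarkedGraph.openGraph.OnRoad r p δ z.2 x v := fun z => by simp
  simp only [h]
  exact Measurable.exists fun x => Measurable.exists fun v =>
    (((measurable_root 0).comp measurable_fst).eq measurable_const).and
    ((((measurable_root 1).comp measurable_fst).eq measurable_const).and
    (SimpleGraph.measurable_onRoad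
      (fun u v => (measurable_adj_openGraph u v).comp measurable_fst)
      (fun v => (measurable_pi_apply v).comp measurable_snd) r p δ x v))

open Classical in
/-- The probability that the second root lies on the road built by the first one. -/
noncomputable def roadMass (X : Type*) [MeasurableSpace X] (r : ℕ) (p δ : I) :
    GraphClass (X × Bool) 2 → ℝ≥0∞ :=
  GraphClass.average (fun g U =>
      if g.toMarkedGraph.openGraph.OnRoad r p δ U (g.root 0) (g.root 1) then 1 else 0)
    ((RootedMarkedGraph.labelInvariant_onRoad r p δ).comp fun P => if P then 1 else 0)
    (Measurable.ite (RootedMarkedGraph.measurable_onRoad_root r p δ).setOf measurable_const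
      measurable_const)

theorem measurable_roadMass : Measurable (roadMass X r p δ) :=
  GraphClass.measurable_average _ _

open Classical in
theorem roadMass_mk (g : RootedMarkedGraph (X × Bool) k) (x y : g.graph.verts) :
    roadMass X r p δ (GraphClass.mk (g.withRoots x y)) = ∫⁻ U,
      (if g.toMarkedGraph.openGraph.OnRoad r p δ U x y then 1 else 0) ∂labelMeasure ℕ := rfl

theorem measurableSet_onRoad (H : SimpleGraph ℕ) (x y : ℕ) :
    MeasurableSet {U : ℕ → I | H.OnRoad r p δ U x y} :=
  (SimpleGraph.measurable_onRoad (H := fun _ : ℕ → I => H) (fun _ _ => measurable_const)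
    measurable_pi_apply r p δ x y).setOf

theorem roadMass_mk_eq_measure (g : RootedMarkedGraph (X × Bool) k) (x y : g.graph.verts) :
    roadMass X r p δ (GraphClass.mk (g.withRoots x y)) =
      labelMeasure ℕ {U | g.toMarkedGraph.openGraph.OnRoad r p δ U x y} := by
  classical
  rw [roadMass_mk, ← lintegral_indicator_one (measurableSet_onRoad _ _ _)]
  refine lintegral_congr fun U => ?_
  simp [Set.indicator_apply]

/-- The root is closed because of a seed in its `N`-ball, which has at most `(D + 1) ^ N` points, or
because of a road through it. Summed over builders, the probabilities of the latter are the mass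
entering the root. -/
theorem labelMeasure_root_mem_roadSet_le {g : RootedMarkedGraph (X × Bool) 1}
    (hg : g.OpenDegreeLE D) :
    labelMeasure ℕ {U | (g.root 0 : ℕ) ∈ (roadFactor X N r p δ).closed g.toMarkedGraph U} ≤
      ((D + 1) ^ N : ℕ) * ENNReal.ofReal δ +
        GraphClass.massIn (roadMass X r p δ) (GraphClass.mk g) := by
  have hsub : {U | (g.root 0 : ℕ) ∈ (roadFactor X N r p δ).closed g.toMarkedGraph U} ⊆
      {U | ∃ t ∈ {t | g.toMarkedGraph.openGraph.edist (g.root 0) t ≤ N}, U t < δ} ∪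
      ⋃ x : g.graph.verts, {U | g.toMarkedGraph.openGraph.OnRoad r p δ U x (g.root 0)} := by
    rintro U (⟨t, ht, hs⟩ | ⟨x, -, hx⟩)
    · exact Or.inl ⟨t, ht, hs.2⟩
    -- The builder is a priori any number; being a hub it has an open edge, hence is a vertex of the
    -- graph.
    · obtain ⟨w, hw⟩ := hx.isHub.1.exists_adj
      exact Or.inr (Set.mem_iUnion.2 ⟨⟨x, hw.1.fst_mem⟩, hx⟩)
  refine (measure_mono hsub).trans ((measure_union_le _ _).trans (add_le_add ?_ ?_))
  · exact labelMeasure_exists_lt_le (SimpleGraph.encard_setOf_edist_le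
      (RootedMarkedGraph.encard_neighborSet_openGraph_le hg) _ N) δ
  · refine (measure_iUnion_le _).trans (le_of_eq ?_)
    exact tsum_congr fun x => (roadMass_mk_eq_measure g x (g.root 0)).symm

/-- The mass leaving the root is the expected number of vertices on its road. This number vanishes
unless the root is a hub, and is almost surely at most `2 * r + 2`. -/
theorem massOut_roadMass_le {g : RootedMarkedGraph (X × Bool) 1} (hp : 0 < p) {K : ℝ} (hK : 0 < K)
    (hball : g.toMarkedGraph.openGraph.Unbounded (g.root 0) →
      K ≤ {w | g.toMarkedGraph.openGraph.edist (g.root 0) w ≤ r}.ncard) :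
    GraphClass.massOut (roadMass X r p δ) (GraphClass.mk g) ≤
      ((2 * r + 2 : ℕ) : ℝ≥0∞) * ENNReal.ofReal (p + 1 / (p * K)) := by
  classical
  set H := g.toMarkedGraph.openGraph with hH
  have hm : MeasurableSet {U : ℕ → I | H.IsHub r p U (g.root 0)} :=
    (SimpleGraph.measurable_isHub (H := fun _ : ℕ → I => H) (fun _ _ => measurable_const)
      measurable_pi_apply r p _).setOf
  calc GraphClass.massOut (roadMass X r p δ) (GraphClass.mk g)
      = ∑' y : g.graph.verts, ∫⁻ U, (if H.OnRoad r p δ U (g.root 0) y then 1 else 0)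
          ∂labelMeasure ℕ := rfl
    _ = ∫⁻ U, ∑' y : g.graph.verts, (if H.OnRoad r p δ U (g.root 0) y then 1 else 0)
          ∂labelMeasure ℕ := by
        refine (lintegral_tsum fun y => Measurable.aemeasurable ?_).symm
        exact Measurable.ite (measurableSet_onRoad H _ _) measurable_const measurable_const
    _ ≤ ∫⁻ U, ((2 * r + 2 : ℕ) : ℝ≥0∞) *
          {U : ℕ → I | H.IsHub r p U (g.root 0)}.indicator 1 U ∂labelMeasure ℕ := by
        refine lintegral_mono_ae ?_
        filter_upwards [ae_injective_labelMeasure] with U hU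
        by_cases hhub : H.IsHub r p U (g.root 0)
        · rw [Set.indicator_of_mem (s := {U | H.IsHub r p U (g.root 0)}) hhub, Pi.one_apply, mul_one]
          exact tsum_ite_le_of_encard_le (SimpleGraph.encard_onRoad_le hU (g.root 0 : ℕ))
        · have hroad : ∀ y, ¬ H.OnRoad r p δ U (g.root 0) y := fun y hy => hhub hy.isHub
          simp [hroad]
    _ = ((2 * r + 2 : ℕ) : ℝ≥0∞) * labelMeasure ℕ {U | H.IsHub r p U (g.root 0)} := by
        rw [lintegral_const_mul' _ _ (ENNReal.natCast_ne_top _), lintegral_indicator_one hm]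
    _ ≤ _ := by
        gcongr
        exact labelMeasure_isHub_le g.finite_neighborSet_openGraph hp hK hball

/-- Mass transport replaces the number of roads through the root, which has no pointwise bound, by
the length of the road that the root builds. -/
theorem percolationRate_roadFactor_law_le {ξ : Measure (GraphClass (X × Bool) 1)}
    (hξ : IsUnimodular ξ) (hdeg : ∀ᵐ q ∂ξ, q.Holds fun g => g.OpenDegreeLE D) (hp : 0 < p) {K : ℝ}
    (hK : 0 < K) (hball : ∀ᵐ q ∂ξ, q.Holds fun g => ∀ v,
      g.toMarkedGraph.openGraph.Unbounded v →
        K ≤ {w | g.toMarkedGraph.openGraph.edist v w ≤ r}.ncard) :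
    percolationRate ((roadFactor X N r p δ).law ξ) ≤ ((D + 1) ^ N : ℕ) * ENNReal.ofReal δ +
      ((2 * r + 2 : ℕ) : ℝ≥0∞) * ENNReal.ofReal (p + 1 / (p * K)) := by
  have := hξ.isProbabilityMeasure
  refine ((roadFactor X N r p δ).percolationRate_law_le
    (B := fun q => ((D + 1) ^ N : ℕ) * ENNReal.ofReal δ +
      GraphClass.massIn (roadMass X r p δ) q) ?_).trans ?_
  · filter_upwards [hdeg] with q hq g hg
    exact labelMeasure_root_mem_roadSet_le (hq g hg)
  · rw [lintegral_add_left measurable_const, lintegral_const, measure_univ, mul_one,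
      ← hξ.massTransport _ measurable_roadMass]
    refine add_le_add_right ?_ _
    have hle : ∀ᵐ q ∂ξ, GraphClass.massOut (roadMass X r p δ) q ≤
        ((2 * r + 2 : ℕ) : ℝ≥0∞) * ENNReal.ofReal (p + 1 / (p * K)) := by
      filter_upwards [hball] with q hq
      induction q using Quotient.inductionOn with
      | _ g => exact massOut_roadMass_le hp hK (hq g rfl (g.root 0))
    refine (lintegral_mono_ae hle).trans ?_
    rw [lintegral_const, measure_univ, mul_one]

end Roads

/-! ### Choice of the parameters and conclusion. -/

theorem theorem5p1 (α : ℝ) (hα : 0 < α) (D : ℕ) (hD : 2 ≤ D)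
    (ε : ℝ) (hε : ε ∈ Set.Ioo (0 : ℝ) (1 / 2)) :
    ∃ h : ℕ, 0 < h ∧
      ∀ (μ : Measure (GraphClass Unit 1)) (ξ : Measure (GraphClass (Unit × Bool) 1)),
        IsUnimodular μ → IsPercolation μ ξ →
        (∀ᵐ q ∂ξ, q.Holds fun g => g.OpenDegreeLE D) →
        (∀ᵐ q ∂ξ, q.Holds fun g => g.InfiniteClustersExpand α) →
        ∀ N : ℕ, 0 < N →
          ∃ ω : Measure (GraphClass ((Unit × Bool) × Bool) 1),
            IsSitePercolation ξ ω ∧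
            percolationRate ω ≤ ENNReal.ofReal ε ∧
            (∀ᵐ q ∂ω, q.Holds fun g => g.ClosedWithin h) ∧
            (∀ᵐ q ∂ω, q.Holds fun g => g.ClosedInLargeConnected N) := by
  obtain ⟨hε0, -⟩ := hε
  -- The cap `1 / 2` keeps `1 - β` positive, so that the growth rate `(1 - β)⁻¹` exceeds `1`.
  set β : ℝ := min α (1 / 2) with hβ
  have hβ0 : 0 < β := lt_min hα (by norm_num)
  have hβ2 : β ≤ 1 / 2 := min_le_right _ _
  have hβα : β ≤ α := min_le_left _ _
  have hγ : 1 < (1 - β)⁻¹ := (one_lt_inv₀ (by linarith)).2 (by linarith)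
  -- Half of `ε` is spent on the roads. This fixes `r`, and with it `h`, before `N` is given.
  obtain ⟨r, hr0, hr⟩ := exists_radius hγ (half_pos hε0)
  refine ⟨r, hr0, fun μ ξ _ hξ hdeg hexp N _ => ?_⟩
  have hr1 : (1 : ℝ) ≤ ((r : ℝ) + 1) ^ 2 := one_le_pow₀ (by linarith [Nat.cast_nonneg (α := ℝ) r])
  set p : unitInterval := ⟨1 / ((r : ℝ) + 1) ^ 2, by positivity,
    div_le_one_of_le₀ hr1 (by positivity)⟩ with hp
  have hp0 : 0 < p := by
    change (0 : ℝ) < 1 / ((r : ℝ) + 1) ^ 2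
    positivity
  have hD : (1 : ℝ) ≤ ((D : ℝ) + 1) ^ N := one_le_pow₀ (by linarith [Nat.cast_nonneg (α := ℝ) D])
  -- The other half of `ε` pays for the `N`-balls around the seeds; `δ` alone depends on `N`. The
  -- minimum with `1` keeps it in the unit interval.
  set δ : unitInterval := ⟨min 1 (ε / 2 / ((D : ℝ) + 1) ^ N), by positivity, min_le_left _ _⟩ with hδ
  have hδ0 : 0 < δ := by
    change (0 : ℝ) < min 1 (ε / 2 / ((D : ℝ) + 1) ^ N)
    positivity
  have hξu := hξ.isMarking.isUnimodular
  have hK : 0 < ((1 - β)⁻¹) ^ r := by positivity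
  have hball : ∀ᵐ q ∂ξ, q.Holds fun g => ∀ v, g.toMarkedGraph.openGraph.Unbounded v →
      ((1 - β)⁻¹) ^ r ≤ ({w | g.toMarkedGraph.openGraph.edist v w ≤ r}.ncard : ℝ) := by
    filter_upwards [hexp] with q hq g hg v hv
    have h := RootedMarkedGraph.one_le_mul_ncard_openGraph (hq g hg) (β := β) (by linarith) hβα hv r
    rw [inv_pow]
    exact (inv_le_iff_one_le_mul₀' (pow_pos (by linarith) r)).2 h
  refine ⟨(roadFactor Unit N r p δ).law ξ, SiteFactor.isSitePercolation_law _ hξu, ?_, ?_, ?_⟩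
  · refine (percolationRate_roadFactor_law_le hξu hdeg hp0 hK hball).trans ?_
    rw [← ENNReal.ofReal_natCast, ← ENNReal.ofReal_natCast (2 * r + 2),
      ← ENNReal.ofReal_mul (by positivity), ← ENNReal.ofReal_mul (by positivity),
      ← ENNReal.ofReal_add (mul_nonneg (by positivity) δ.2.1)
        (mul_nonneg (by positivity) (add_nonneg p.2.1 (div_nonneg zero_le_one
          (mul_nonneg p.2.1 hK.le))))]
    refine ENNReal.ofReal_le_ofReal ?_
    have h1 : ((D : ℝ) + 1) ^ N * (δ : ℝ) ≤ ε / 2 := by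
      calc ((D : ℝ) + 1) ^ N * (δ : ℝ) ≤ ((D : ℝ) + 1) ^ N * (ε / 2 / ((D : ℝ) + 1) ^ N) :=
            mul_le_mul_of_nonneg_left (min_le_right _ _) (by positivity)
        _ = ε / 2 := by field_simp
    push_cast
    linarith
  · refine Filter.Eventually.mono (SiteFactor.ae_holds_law _
      (fun _ _ => RootedMarkedGraph.ClosedNearUnbounded.of_isomorphic)
      (RootedMarkedGraph.measurable_closedNearUnbounded r) (Filter.Eventually.of_forall
      fun q g _ => g.closedNearUnbounded_siteMark hδ0)) fun q hq g hg => (hq g hg).closedWithin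
  · refine Filter.Eventually.mono (SiteFactor.ae_holds_law _
      (fun _ _ => RootedMarkedGraph.ClosedInLongClusters.of_isomorphic)
      (RootedMarkedGraph.measurable_closedInLongClusters N) (Filter.Eventually.of_forall
      fun q g _ => Filter.Eventually.of_forall g.closedInLongClusters_siteMark))
      fun q hq g hg => (hq g hg).closedInLargeConnected
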